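/- Let $M$ be a smooth manifold of dimension $2n+1$ with a Riemannian metric $\langle\cdot,\cdot\rangle$, Levi-Civita connection $\nabla$ and curvature $\mathrm{Rm}(X,Y)Z=\nabla_X\nabla_YZ-\nabla_Y\nabla_XZ-\nabla_{[X,Y]}Z$. Let $J$ be a smooth $(1,1)$-tensor, $\mathbf R$ a smooth vector field and $\alpha$ a smooth $1$-form on $M$, put $D=\ker\alpha$, and use the convention $d\alpha(X,Y)=X(\alpha(Y))-Y(\alpha(X))-\alpha([X,Y])$. Assume that $(M,J,\mathbf R,\alpha,\langle\cdot,\cdot\rangle)$ is Sasakian, that is: - $d\alpha$ is nondegenerate on $D$; $J^2v=-v$ for $v\in D$; $\alpha(\mathbf R)=1$; $J\mathbf R=0$; - $\langle Jv,Jw\rangle=\langle v,w\rangle$ for $v,w\in D$; $\langle\mathbf R,\mathbf R\rangle=1$; $\langle v,Jw\rangle=d\alpha(v,w)$ for all tangent vectors $v,w$; - $J^2[X,Y]+[JX,JY]-J[JX,Y]-J[X,JY]+d\alpha(X,Y)\mathbf R=0$ for all vector fields $X,Y$. Let $\overline\nabla$ be the Tanaka connection, $$\overline\nabla_XY=\nabla_XY+\tfrac12\langle\mathbf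 R,X\rangle JY+\tfrac12\langle\mathbf R,Y\rangle JX-\tfrac12\langle JX,Y\rangle\mathbf R,$$ let $\overline{\mathrm{Rm}}$ be its curvature (defined by the same formula as $\mathrm{Rm}$), and let $\overline{\mathrm{Ric}}(v,v)$ be the trace of $w\mapsto\langle\overline{\mathrm{Rm}}(w,v)v,w\rangle$. For a tangent vector $v$ let $v_H$ and $v_V$ be its orthogonal projections onto $D$ and $D^\perp$, and put $$\mathrm{Ric}^H(v,v)=\sum_i\langle\mathrm{Rm}(v_i,v)v,v_i\rangle,\qquad \mathrm{Ric}^V(v,v)=\sum_j\langle\mathrm{Rm}(u_j,v)v,u_j\rangle,$$ where $(v_i)$ and $(u_j)$ are orthonormal bases of $D$ and $D^\perp$ at the base point of $v$. Then, for every tangent vector $v$ of $M$, 1. $\mathrm{Ric}^V(v,v)=\mathrm{Ric}^V(v_H,v_H)=\frac14|v_H|^2$; 2. $\mathrm{Ric}^H(v,v)+3\,\mathrm{Ric}^V(v_H,v_H)=\mathrm{Ric}^H(v,v)+\frac34|v_H|^2=\frac n2|v_V|^2+\overline{\mathrm{Ric}}(v_H,v_H)$. -/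

import Mathlib

open Bundle Manifold VectorField
open scoped ContDiff

noncomputable section

set_option linter.unusedSectionVars false

namespace SasakiGeometry

section Tensors

variable {E : Type*} [NormedAddCommGroup E] [NormedSpace ℝ E]
  {H : Type*} [TopologicalSpace H] {I : ModelWithCorners ℝ E H}
  {M : Type*} [TopologicalSpace M] [ChartedSpace H M]

/-- `oneFormD α X Y` is the function
`dα(X, Y) = X(α(Y)) - Y(α(X)) - α([X, Y])` on `M` (no factor `1/2`), for a 1-form `α` and vector
fields `X`, `Y`. -/
def oneFormD (α : Π x : M, TangentSpace I x →L[ℝ] ℝ) (X Y : Π x : M, TangentSpace I x) (x : M) : ℝ :=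
  mvfderiv I (fun y ↦ α y (Y y)) x (X x) - mvfderiv I (fun y ↦ α y (X y)) x (Y x)
    - α x (mlieBracket I X Y x)

/-- `nijenhuis J X Y` is the vector field
`[J, J](X, Y) = J²[X, Y] + [JX, JY] - J[JX, Y] - J[X, JY]`. -/
def nijenhuis (J : Π x : M, TangentSpace I x →L[ℝ] TangentSpace I x)
    (X Y : Π x : M, TangentSpace I x) (x : M) : TangentSpace I x :=
  J x (J x (mlieBracket I X Y x)) + mlieBracket I (fun y ↦ J y (X y)) (fun y ↦ J y (Y y)) x
    - J x (mlieBracket I (fun y ↦ J y (X y)) Y x) - J x (mlieBracket I X (fun y ↦ J y (Y y)) x)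

/-- The contact distribution `D = ker α` at `x`. -/
def distribution (α : Π x : M, TangentSpace I x →L[ℝ] ℝ) (x : M) :
    Submodule ℝ (TangentSpace I x) := (α x).ker

/-- The curvature of an operation `D X Y` (written `∇_X Y` on paper) on vector fields:
`Rm(X, Y)Z = ∇_X ∇_Y Z - ∇_Y ∇_X Z - ∇_{[X, Y]} Z`. -/
def curvature (D : (Π x : M, TangentSpace I x) → (Π x : M, TangentSpace I x) →
      (Π x : M, TangentSpace I x)) (X Y Z : Π x : M, TangentSpace I x) (x : M) :
    TangentSpace I x :=
  D X (D Y Z) x - D Y (D X Z) x - D (mlieBracket I X Y) Z x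

variable [IsManifold I ∞ M]

/-- The curvature `Rm(u, v)w` on tangent vectors at `x`: `Rm(U, V)W` at `x` for the vector fields
`U`, `V`, `W`, smooth near `x`, which extend `u`, `v`, `w`. -/
def curvatureAt (D : (Π x : M, TangentSpace I x) → (Π x : M, TangentSpace I x) →
      (Π x : M, TangentSpace I x)) {x : M} (u v w : TangentSpace I x) : TangentSpace I x :=
  curvature D (FiberBundle.extend E u) (FiberBundle.extend E v) (FiberBundle.extend E w) x

/-- The 2-form `dα` on tangent vectors at `x`, computed on extensions to vector fields; it does not
depend on the extensions, see `oneFormDAt_apply`. -/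
def oneFormDAt (α : Π x : M, TangentSpace I x →L[ℝ] ℝ) {x : M} (v w : TangentSpace I x) : ℝ :=
  oneFormD α (FiberBundle.extend E v) (FiberBundle.extend E w) x

/-- The Nijenhuis tensor on tangent vectors at `x`, computed on extensions to vector fields; it does
not depend on the extensions, see `nijenhuisAt_apply`. -/
def nijenhuisAt (J : Π x : M, TangentSpace I x →L[ℝ] TangentSpace I x) {x : M}
    (v w : TangentSpace I x) : TangentSpace I x :=
  nijenhuis J (FiberBundle.extend E v) (FiberBundle.extend E w) x

variable (I) in
/-- A smooth vector field. -/
def SmoothField (X : Π x : M, TangentSpace I x) : Prop :=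
  ContMDiff I (I.prod 𝓘(ℝ, E)) ∞ (fun x ↦ TotalSpace.mk' E (E := fun x : M ↦ TangentSpace I x) x (X x))

variable (I) in
/-- A smooth 1-form. -/
def SmoothOneForm (α : Π x : M, TangentSpace I x →L[ℝ] ℝ) : Prop :=
  ContMDiff I (I.prod 𝓘(ℝ, E →L[ℝ] ℝ)) ∞
    (fun x ↦ TotalSpace.mk' (E →L[ℝ] ℝ) (E := fun x : M ↦ TangentSpace I x →L[ℝ] ℝ) x (α x))

variable (I) in
/-- A smooth (1,1)-tensor. -/
def SmoothEndo (J : Π x : M, TangentSpace I x →L[ℝ] TangentSpace I x) : Prop :=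
  ContMDiff I (I.prod 𝓘(ℝ, E →L[ℝ] E)) ∞
    (fun x ↦ TotalSpace.mk' (E →L[ℝ] E)
      (E := fun x : M ↦ TangentSpace I x →L[ℝ] TangentSpace I x) x (J x))

lemma SmoothOneForm.mdifferentiableAt {α : Π x : M, TangentSpace I x →L[ℝ] ℝ}
    (hα : SmoothOneForm I α) {X : Π x : M, TangentSpace I x} {x : M} (hX : MDiffAt (T% X) x) :
    MDiffAt (fun y ↦ α y (X y)) x := by
  have h : MDifferentiableAt I (I.prod 𝓘(ℝ)) (fun m ↦ TotalSpace.mk' ℝ (E := Bundle.Trivial M ℝ)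
      m (α m (X m))) x :=
    MDifferentiableAt.clm_bundle_apply (F₁ := E) (b := fun y ↦ y)
      (E₁ := fun x : M ↦ TangentSpace I x) (E₂ := Bundle.Trivial M ℝ)
      ((hα x).mdifferentiableAt (by simp)) hX
  rw [mdifferentiableAt_totalSpace] at h
  exact h.2

lemma SmoothEndo.mdifferentiableAt {J : Π x : M, TangentSpace I x →L[ℝ] TangentSpace I x}
    (hJ : SmoothEndo I J) {X : Π x : M, TangentSpace I x} {x : M} (hX : MDiffAt (T% X) x) :
    MDiffAt (T% (fun y ↦ J y (X y))) x :=
  MDifferentiableAt.clm_bundle_apply (F₁ := E) (F₂ := E) (b := fun y ↦ y)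
    (E₁ := fun x : M ↦ TangentSpace I x) (E₂ := fun x : M ↦ TangentSpace I x)
    ((hJ x).mdifferentiableAt (by simp)) hX

lemma oneFormD_swap (α : Π x : M, TangentSpace I x →L[ℝ] ℝ) (X Y : Π x : M, TangentSpace I x)
    (x : M) : oneFormD α X Y x = - oneFormD α Y X x := by
  simp only [oneFormD, mlieBracket_swap_apply (V := X) (W := Y), map_neg]
  ring

lemma nijenhuis_swap (J : Π x : M, TangentSpace I x →L[ℝ] TangentSpace I x)
    (X Y : Π x : M, TangentSpace I x) (x : M) : nijenhuis J X Y x = - nijenhuis J Y X x := by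
  simp only [nijenhuis, mlieBracket_swap_apply (V := X), map_neg,
    mlieBracket_swap_apply (V := fun y ↦ J y (X y))]
  abel

variable [FiniteDimensional ℝ E]

lemma oneFormD_tensorial {α : Π x : M, TangentSpace I x →L[ℝ] ℝ} (hα : SmoothOneForm I α)
    {Y : Π x : M, TangentSpace I x} {x : M} :
    TensorialAt I E (fun X : Π x : M, TangentSpace I x ↦ oneFormD α X Y x) x where
  smul {f X} hf hX := by
    have e : (fun y ↦ α y ((f • X) y)) = f * fun y ↦ α y (X y) := by ext y; simp
    simp only [oneFormD, e, mvfderiv_mul hf (hα.mdifferentiableAt hX), mlieBracket_smul_left hf hX]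
    simp
    ring
  add {X X'} hX hX' := by
    have e : (fun y ↦ α y ((X + X') y)) = (fun y ↦ α y (X y)) + fun y ↦ α y (X' y) := by
      ext y; simp
    simp only [oneFormD, e, mvfderiv_add (hα.mdifferentiableAt hX) (hα.mdifferentiableAt hX'),
      mlieBracket_add_left hX hX']
    simp
    ring

lemma nijenhuis_tensorial {J : Π x : M, TangentSpace I x →L[ℝ] TangentSpace I x}
    (hJ : SmoothEndo I J) {Y : Π x : M, TangentSpace I x} {x : M} :
    TensorialAt I E (fun X : Π x : M, TangentSpace I x ↦ nijenhuis J X Y x) x where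
  smul {f X} hf hX := by
    have e : (fun y ↦ J y ((f • X) y)) = f • fun y ↦ J y (X y) := by ext y; simp
    simp only [nijenhuis, e, mlieBracket_smul_left hf hX,
      mlieBracket_smul_left hf (hJ.mdifferentiableAt hX)]
    simp
    module
  add {X X'} hX hX' := by
    have e : (fun y ↦ J y ((X + X') y)) = (fun y ↦ J y (X y)) + fun y ↦ J y (X' y) := by
      ext y; simp
    simp only [nijenhuis, e, mlieBracket_add_left hX hX',
      mlieBracket_add_left (hJ.mdifferentiableAt hX) (hJ.mdifferentiableAt hX')]
    simp
    abel

/-- `dα` is a tensor. -/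
lemma oneFormDAt_apply {α : Π x : M, TangentSpace I x →L[ℝ] ℝ} (hα : SmoothOneForm I α)
    {X Y : Π x : M, TangentSpace I x} {x : M} (hX : MDiffAt (T% X) x) (hY : MDiffAt (T% Y) x) :
    oneFormDAt α (X x) (Y x) = oneFormD α X Y x := by
  have hX' := FiberBundle.mdifferentiableAt_extend (F := E) I (X x)
  have hY' := FiberBundle.mdifferentiableAt_extend (F := E) I (Y x)
  rw [oneFormDAt, (oneFormD_tensorial hα).pointwise hX' hX (by simp), oneFormD_swap,
    (oneFormD_tensorial hα).pointwise hY' hY (by simp), ← oneFormD_swap]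

/-- The Nijenhuis tensor is a tensor. -/
lemma nijenhuisAt_apply {J : Π x : M, TangentSpace I x →L[ℝ] TangentSpace I x}
    (hJ : SmoothEndo I J) {X Y : Π x : M, TangentSpace I x} {x : M}
    (hX : MDiffAt (T% X) x) (hY : MDiffAt (T% Y) x) :
    nijenhuisAt J (X x) (Y x) = nijenhuis J X Y x := by
  have hX' := FiberBundle.mdifferentiableAt_extend (F := E) I (X x)
  have hY' := FiberBundle.mdifferentiableAt_extend (F := E) I (Y x)
  rw [nijenhuisAt, (nijenhuis_tensorial hJ).pointwise hX' hX (by simp), nijenhuis_swap,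
    (nijenhuis_tensorial hJ).pointwise hY' hY (by simp), ← nijenhuis_swap]

/-- A contact form: a smooth 1-form `α` such that `dα` is nondegenerate on `D = ker α`. -/
structure IsContact (α : Π x : M, TangentSpace I x →L[ℝ] ℝ) : Prop where
  smooth : SmoothOneForm I α
  nondegenerate : ∀ (x : M), ∀ v ∈ distribution α x,
    (∀ w ∈ distribution α x, oneFormDAt α v w = 0) → v = 0

/-- An almost contact structure `(J, R, α)`. -/
structure IsAlmostContact (J : Π x : M, TangentSpace I x →L[ℝ] TangentSpace I x)
    (R : Π x : M, TangentSpace I x) (α : Π x : M, TangentSpace I x →L[ℝ] ℝ) : Prop where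
  smooth_J : SmoothEndo I J
  smooth_R : SmoothField I R
  contact : IsContact α
  sq : ∀ (x : M), ∀ v ∈ distribution α x, J x (J x v) = -v
  form_R : ∀ x : M, α x (R x) = 1
  J_R : ∀ x : M, J x (R x) = 0

/-- Normality of `(J, R, α)`: `[J, J] + dα ⊗ R = 0`. -/
def IsNormal (J : Π x : M, TangentSpace I x →L[ℝ] TangentSpace I x)
    (R : Π x : M, TangentSpace I x) (α : Π x : M, TangentSpace I x →L[ℝ] ℝ) : Prop :=
  ∀ (x : M) (v w : TangentSpace I x), nijenhuisAt J v w + oneFormDAt α v w • R x = 0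

end Tensors

section Riemannian

variable {E : Type*} [NormedAddCommGroup E] [NormedSpace ℝ E] [FiniteDimensional ℝ E]
  {H : Type*} [TopologicalSpace H] {I : ModelWithCorners ℝ E H}
  {M : Type*} [TopologicalSpace M] [ChartedSpace H M] [IsManifold I ∞ M]
  [RiemannianBundle (fun x : M ↦ TangentSpace I x)]

/-- The function `⟨X, Y⟩` on `M`. -/
def metricFn (X Y : Π x : M, TangentSpace I x) (x : M) : ℝ := inner ℝ (X x) (Y x)

lemma metricFn_comm (X Y : Π x : M, TangentSpace I x) : metricFn X Y = metricFn Y X := by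
  ext y; exact real_inner_comm _ _

/-- Half of the right-hand side of the Koszul formula. It is the value of `⟨∇_X Y, Z⟩` for the
Levi-Civita connection `∇`. -/
def koszul (X Y Z : Π x : M, TangentSpace I x) (x : M) : ℝ :=
  (1 / 2 : ℝ) * (mvfderiv I (metricFn Y Z) x (X x) + mvfderiv I (metricFn X Z) x (Y x)
    - mvfderiv I (metricFn X Y) x (Z x) + inner ℝ (mlieBracket I X Y x) (Z x)
    - inner ℝ (mlieBracket I X Z x) (Y x) - inner ℝ (mlieBracket I Y Z x) (X x))

variable [IsContMDiffRiemannianBundle I ∞ E (fun x : M ↦ TangentSpace I x)]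

lemma mdifferentiableAt_metricFn {X Y : Π x : M, TangentSpace I x} {x : M}
    (hX : MDiffAt (T% X) x) (hY : MDiffAt (T% Y) x) : MDiffAt (metricFn X Y) x :=
  MDifferentiableAt.inner_bundle (E := fun x : M ↦ TangentSpace I x) (F := E) (IB := I) (IM := I)
    (b := fun y ↦ y) hX hY

lemma mvfderiv_metricFn_smul {f : M → ℝ} {X Y : Π x : M, TangentSpace I x} {x : M}
    (hf : MDiffAt f x) (hX : MDiffAt (T% X) x) (hY : MDiffAt (T% Y) x) (v : TangentSpace I x) :
    mvfderiv I (metricFn (f • X) Y) x v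
      = f x * mvfderiv I (metricFn X Y) x v + inner ℝ (X x) (Y x) * mvfderiv I f x v := by
  have e : metricFn (f • X) Y = f * metricFn X Y := by
    ext y; simp [metricFn, inner_smul_left]
  rw [e, mvfderiv_mul hf (mdifferentiableAt_metricFn hX hY)]
  simp [metricFn]

lemma mvfderiv_metricFn_add {X X' Y : Π x : M, TangentSpace I x} {x : M}
    (hX : MDiffAt (T% X) x) (hX' : MDiffAt (T% X') x) (hY : MDiffAt (T% Y) x)
    (v : TangentSpace I x) :
    mvfderiv I (metricFn (X + X') Y) x v
      = mvfderiv I (metricFn X Y) x v + mvfderiv I (metricFn X' Y) x v := by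
  have e : metricFn (X + X') Y = metricFn X Y + metricFn X' Y := by
    ext y; simp [metricFn, inner_add_left]
  rw [e, mvfderiv_add (mdifferentiableAt_metricFn hX hY) (mdifferentiableAt_metricFn hX' hY)]
  simp

lemma koszul_tensorial_left {Y Z : Π x : M, TangentSpace I x} {x : M}
    (hY : MDiffAt (T% Y) x) (hZ : MDiffAt (T% Z) x) :
    TensorialAt I E (fun X : Π x : M, TangentSpace I x ↦ koszul X Y Z x) x where
  smul {f X} hf hX := by
    simp only [koszul, mvfderiv_metricFn_smul hf hX hZ, mvfderiv_metricFn_smul hf hX hY,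
      mlieBracket_smul_left hf hX, inner_add_left, inner_smul_left, inner_smul_right,
      Pi.smul_apply', map_smul, smul_eq_mul, RCLike.conj_to_real]
    ring
  add {X X'} hX hX' := by
    simp only [koszul, mvfderiv_metricFn_add hX hX' hZ, mvfderiv_metricFn_add hX hX' hY,
      mlieBracket_add_left hX hX', inner_add_left, inner_add_right, Pi.add_apply, map_add]
    ring

lemma koszul_tensorial_right {X Y : Π x : M, TangentSpace I x} {x : M}
    (hX : MDiffAt (T% X) x) (hY : MDiffAt (T% Y) x) :
    TensorialAt I E (fun Z : Π x : M, TangentSpace I x ↦ koszul X Y Z x) x where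
  smul {f Z} hf hZ := by
    simp only [koszul, metricFn_comm Y (f • Z), metricFn_comm X (f • Z),
      metricFn_comm Y Z, metricFn_comm X Z, mvfderiv_metricFn_smul hf hZ hX,
      mvfderiv_metricFn_smul hf hZ hY,
      mlieBracket_smul_right hf hZ, inner_add_left, inner_smul_left, inner_smul_right,
      Pi.smul_apply', map_smul, smul_eq_mul, RCLike.conj_to_real]
    rw [real_inner_comm (X x) (Z x), real_inner_comm (Y x) (Z x)]
    ring
  add {Z Z'} hZ hZ' := by
    simp only [koszul, metricFn_comm Y (Z + Z'), metricFn_comm X (Z + Z'),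
      metricFn_comm Y Z, metricFn_comm X Z, metricFn_comm Y Z', metricFn_comm X Z',
      mvfderiv_metricFn_add hZ hZ' hX, mvfderiv_metricFn_add hZ hZ' hY,
      mlieBracket_add_right hZ hZ', inner_add_left, inner_add_right, Pi.add_apply, map_add]
    ring

lemma koszul_smul_middle {f : M → ℝ} {X Y Z : Π x : M, TangentSpace I x} {x : M}
    (hf : MDiffAt f x) (hX : MDiffAt (T% X) x) (hY : MDiffAt (T% Y) x) (hZ : MDiffAt (T% Z) x) :
    koszul X (f • Y) Z x
      = f x * koszul X Y Z x + mvfderiv I f x (X x) * inner ℝ (Y x) (Z x) := by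
  simp only [koszul, metricFn_comm X (f • Y), metricFn_comm X Y,
    mvfderiv_metricFn_smul hf hY hX, mvfderiv_metricFn_smul hf hY hZ,
    mlieBracket_smul_right hf hY, mlieBracket_smul_left hf hY, inner_add_left, inner_smul_left,
    inner_smul_right, Pi.smul_apply', map_smul, smul_eq_mul, RCLike.conj_to_real]
  ring

lemma koszul_add_middle {X Y Y' Z : Π x : M, TangentSpace I x} {x : M}
    (hX : MDiffAt (T% X) x) (hY : MDiffAt (T% Y) x) (hY' : MDiffAt (T% Y') x)
    (hZ : MDiffAt (T% Z) x) :
    koszul X (Y + Y') Z x = koszul X Y Z x + koszul X Y' Z x := by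
  simp only [koszul, metricFn_comm X (Y + Y'), metricFn_comm X Y, metricFn_comm X Y',
    mvfderiv_metricFn_add hY hY' hX, mvfderiv_metricFn_add hY hY' hZ,
    mlieBracket_add_right hY hY', mlieBracket_add_left hY hY', inner_add_left, inner_add_right,
    Pi.add_apply, map_add]
  ring

/-- The Koszul form of `Y` at `x`, as a bilinear form on the tangent space. -/
def koszulForm (Y : Π x : M, TangentSpace I x) (x : M) (hY : MDiffAt (T% Y) x) :
    TangentSpace I x →L[ℝ] TangentSpace I x →L[ℝ] ℝ :=
  TensorialAt.mkHom₂ (I := I) (F := E) (F' := E) (fun X Z ↦ koszul X Y Z x) x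
    (fun _ hZ ↦ koszul_tensorial_left hY hZ) (fun _ hX ↦ koszul_tensorial_right hX hY)

lemma koszulForm_apply {X Y Z : Π x : M, TangentSpace I x} {x : M}
    (hX : MDiffAt (T% X) x) (hY : MDiffAt (T% Y) x) (hZ : MDiffAt (T% Z) x) :
    koszulForm Y x hY (X x) (Z x) = koszul X Y Z x :=
  TensorialAt.mkHom₂_apply (I := I) (F := E) (F' := E) (Φ := fun X Z ↦ koszul X Y Z x) (x := x)
    (fun _ hZ ↦ koszul_tensorial_left hY hZ) (fun _ hX ↦ koszul_tensorial_right hX hY) hX hZ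

instance (x : M) : FiniteDimensional ℝ (TangentSpace I x) :=
  inferInstanceAs (FiniteDimensional ℝ E)

instance (x : M) : CompleteSpace (TangentSpace I x) :=
  FiniteDimensional.complete ℝ (TangentSpace I x)

open Classical in
/-- The operator `(Y, x) ↦ (∇ Y)_x` of the Levi-Civita connection, given by the Koszul formula. -/
def leviCivitaFun (Y : Π x : M, TangentSpace I x) (x : M) :
    TangentSpace I x →L[ℝ] TangentSpace I x :=
  if hY : MDiffAt (T% Y) x then
    LinearMap.toContinuousLinearMap
      { toFun := fun v ↦ (InnerProductSpace.toDual ℝ (TangentSpace I x)).symm (koszulForm Y x hY v)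
        map_add' := fun v w ↦ by simp
        map_smul' := fun c v ↦ by simp }
  else 0

lemma inner_leviCivitaFun {X Y Z : Π x : M, TangentSpace I x} {x : M}
    (hX : MDiffAt (T% X) x) (hY : MDiffAt (T% Y) x) (hZ : MDiffAt (T% Z) x) :
    inner ℝ (leviCivitaFun Y x (X x)) (Z x) = koszul X Y Z x := by
  rw [leviCivitaFun, dif_pos hY, ← koszulForm_apply hX hY hZ]
  exact InnerProductSpace.toDual_symm_apply

lemma inner_leviCivitaFun_extend {Y : Π x : M, TangentSpace I x} {x : M}
    (hY : MDiffAt (T% Y) x) (v w : TangentSpace I x) :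
    inner ℝ (leviCivitaFun Y x v) w
      = koszul (FiberBundle.extend E v) Y (FiberBundle.extend E w) x := by
  simpa using inner_leviCivitaFun (FiberBundle.mdifferentiableAt_extend (F := E) I v) hY
    (FiberBundle.mdifferentiableAt_extend (F := E) I w)

variable (I M) in
/-- The Levi-Civita connection of a Riemannian manifold. -/
def leviCivita : CovariantDerivative I E (fun x : M ↦ TangentSpace I x) where
  toFun := leviCivitaFun
  isCovariantDerivativeOnUniv :=
    { add := fun {σ σ' x} hσ hσ' _ ↦ by
        ext v
        refine ext_inner_right ℝ fun w ↦ ?_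
        have h : MDiffAt (T% (σ + σ')) x := mdifferentiableAt_add_section hσ hσ'
        rw [add_apply, inner_add_left, inner_leviCivitaFun_extend h,
          inner_leviCivitaFun_extend hσ, inner_leviCivitaFun_extend hσ', koszul_add_middle _ hσ hσ']
        all_goals exact FiberBundle.mdifferentiableAt_extend ..
      leibniz := fun {σ g x} hσ hg _ ↦ by
        ext v
        refine ext_inner_right ℝ fun w ↦ ?_
        have h : MDiffAt (T% (g • σ)) x := hg.smul_section hσ
        rw [add_apply, inner_add_left, inner_leviCivitaFun_extend h,
          smul_apply, inner_smul_left,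
          inner_leviCivitaFun_extend hσ, koszul_smul_middle hg _ hσ]
        · simp [inner_smul_left]
        all_goals exact FiberBundle.mdifferentiableAt_extend .. }

/-- The Koszul formula. -/
lemma inner_leviCivita {X Y Z : Π x : M, TangentSpace I x} {x : M}
    (hX : MDiffAt (T% X) x) (hY : MDiffAt (T% Y) x) (hZ : MDiffAt (T% Z) x) :
    inner ℝ (leviCivita I M Y x (X x)) (Z x) = koszul X Y Z x :=
  inner_leviCivitaFun hX hY hZ

/-- The Levi-Civita connection is torsion-free. -/
lemma leviCivita_sub_swap {X Y : Π x : M, TangentSpace I x} {x : M}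
    (hX : MDiffAt (T% X) x) (hY : MDiffAt (T% Y) x) :
    leviCivita I M Y x (X x) - leviCivita I M X x (Y x) = mlieBracket I X Y x := by
  refine ext_inner_right ℝ fun w ↦ ?_
  have hW := FiberBundle.mdifferentiableAt_extend (F := E) I w
  have h1 := inner_leviCivita hX hY hW
  have h2 := inner_leviCivita hY hX hW
  rw [FiberBundle.extend_apply_self] at h1 h2
  rw [inner_sub_left, h1, h2]
  simp only [koszul, metricFn_comm X Y, mlieBracket_swap_apply (V := Y) (W := X), inner_neg_left,
    FiberBundle.extend_apply_self]
  ring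

/-- The Levi-Civita connection is compatible with the metric. -/
lemma mvfderiv_metricFn {X Y Z : Π x : M, TangentSpace I x} {x : M}
    (hX : MDiffAt (T% X) x) (hY : MDiffAt (T% Y) x) (hZ : MDiffAt (T% Z) x) :
    mvfderiv I (metricFn Y Z) x (X x)
      = inner ℝ (leviCivita I M Y x (X x)) (Z x) + inner ℝ (Y x) (leviCivita I M Z x (X x)) := by
  rw [← real_inner_comm (Y x), inner_leviCivita hX hY hZ, inner_leviCivita hX hZ hY]
  simp only [koszul, metricFn_comm Z Y, mlieBracket_swap_apply (V := Z) (W := Y), inner_neg_left]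
  ring

/-- An almost contact metric structure. -/
structure IsAlmostContactMetric (J : Π x : M, TangentSpace I x →L[ℝ] TangentSpace I x)
    (R : Π x : M, TangentSpace I x) (α : Π x : M, TangentSpace I x →L[ℝ] ℝ) : Prop
    extends IsAlmostContact J R α where
  inner_J : ∀ (x : M), ∀ v ∈ distribution α x, ∀ w ∈ distribution α x,
    inner ℝ (J x v) (J x w) = inner ℝ v w
  inner_R : ∀ x : M, inner ℝ (R x) (R x) = 1

/-- A contact metric structure: `⟨v, Jw⟩ = dα(v, w)`. -/
structure IsContactMetric (J : Π x : M, TangentSpace I x →L[ℝ] TangentSpace I x)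
    (R : Π x : M, TangentSpace I x) (α : Π x : M, TangentSpace I x →L[ℝ] ℝ) : Prop
    extends IsAlmostContactMetric J R α where
  inner_eq : ∀ (x : M) (v w : TangentSpace I x), inner ℝ v (J x w) = oneFormDAt α v w

/-- A Sasakian structure: a normal contact metric structure. -/
structure IsSasakian (J : Π x : M, TangentSpace I x →L[ℝ] TangentSpace I x)
    (R : Π x : M, TangentSpace I x) (α : Π x : M, TangentSpace I x →L[ℝ] ℝ) : Prop
    extends IsContactMetric J R α where
  normal : IsNormal J R α

variable (I M) in
/-- The Levi-Civita connection `(X, Y) ↦ ∇_X Y` as an operation on vector fields. -/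
def nabla (X Y : Π x : M, TangentSpace I x) (x : M) : TangentSpace I x :=
  leviCivita I M Y x (X x)

/-- The Tanaka connection `(X, Y) ↦ ∇̄_X Y`. -/
def tanaka (J : Π x : M, TangentSpace I x →L[ℝ] TangentSpace I x) (R : Π x : M, TangentSpace I x)
    (X Y : Π x : M, TangentSpace I x) (x : M) : TangentSpace I x :=
  nabla I M X Y x + (1 / 2 : ℝ) • inner ℝ (R x) (X x) • J x (Y x)
    + (1 / 2 : ℝ) • inner ℝ (R x) (Y x) • J x (X x)
    - (1 / 2 : ℝ) • inner ℝ (J x (X x)) (Y x) • R x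

/-- The sum of `⟨Rm(e, v)v, e⟩` over an orthonormal basis `(e)` of a subspace `S` of the tangent
space at `x`, where `Rm` is the Riemann curvature tensor. -/
def partialRicci {x : M} (S : Submodule ℝ (TangentSpace I x)) (v : TangentSpace I x) : ℝ :=
  ∑ i, inner ℝ (curvatureAt (nabla I M) (stdOrthonormalBasis ℝ S i : TangentSpace I x) v v)
    (stdOrthonormalBasis ℝ S i : TangentSpace I x)

/-- The horizontal Ricci curvature `Ric^H(v, v)`. -/
def ricciH (α : Π x : M, TangentSpace I x →L[ℝ] ℝ) {x : M} (v : TangentSpace I x) : ℝ :=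
  partialRicci (distribution α x) v

/-- The vertical Ricci curvature `Ric^V(v, v)`. -/
def ricciV (α : Π x : M, TangentSpace I x →L[ℝ] ℝ) {x : M} (v : TangentSpace I x) : ℝ :=
  partialRicci (distribution α x)ᗮ v

/-- The Ricci curvature of the Tanaka connection on the diagonal: the trace of
`w ↦ ⟨Rm̄(w, v)v, w⟩`, computed in an orthonormal basis of the tangent space. -/
def tanakaRicci (J : Π x : M, TangentSpace I x →L[ℝ] TangentSpace I x)
    (R : Π x : M, TangentSpace I x) {x : M} (v : TangentSpace I x) : ℝ :=
  ∑ i, inner ℝ (curvatureAt (tanaka J R) (stdOrthonormalBasis ℝ (TangentSpace I x) i) v v)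
    (stdOrthonormalBasis ℝ (TangentSpace I x) i)

/-- The horizontal part of a tangent vector. -/
def horPart (α : Π x : M, TangentSpace I x →L[ℝ] ℝ) {x : M} (v : TangentSpace I x) :
    TangentSpace I x := (distribution α x).starProjection v

/-- The vertical part of a tangent vector. -/
def verPart (α : Π x : M, TangentSpace I x →L[ℝ] ℝ) {x : M} (v : TangentSpace I x) :
    TangentSpace I x := (distribution α x)ᗮ.starProjection v

end Riemannian

end SasakiGeometry

end

/-!
Everything is reduced to the Riemann curvature tensor `⟨Rm(u, v)w, z⟩` (`riem`) and to the first
derivatives of `R` and `J`.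

The metric determines the structure at a point: `R` is the unit normal of `D`, so `α = ⟨R, ·⟩`, the
tensor `J` is skew-symmetric and `J² = -1 + α ⊗ R`. Hence `dα` is twice the skew part of `∇R`, and
closedness of `dα = ⟨·, J ·⟩` is the first Bianchi identity applied to `R`
(`IsContactMetric.nablaEndo_cyclic`). Written with `∇`, normality is a linear equation for `∇J`.
For the pair `(X, R)` it kills the symmetric part of `∇R`, so `∇_X R = -1/2 JX`
(`IsSasakian.nabla_R`); the argument that makes `∇J` vanish on a Kähler manifold, applied to the
difference of the two sides, then gives `(∇_X J)Y = 1/2 (⟨X, Y⟩R - α(Y)X)`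
(`IsSasakian.nablaEndo_eq`). Differentiating `∇R` once more yields
`Rm(X, Y)R = 1/4 (α(Y)X - α(X)Y)` (`IsSasakian.riem_R`). This gives `Ric^V`, shows that the mixed
terms of `Ric^H(v_H + v_V)` vanish, and gives `Ric^H(R, R) = 2n / 4`.

For the Tanaka connection, expanding its curvature with the formulas for `∇R` and `∇J` gives, for
horizontal `v` and arbitrary `w`,
`⟨Rm̄(w, v)v, w⟩ = ⟨Rm(w, v)v, w⟩ + 3/4 ⟨Jv, w⟩² - 1/4 |v|² α(w)²`
(`IsSasakian.inner_curvatureAt_tanaka`), whose trace is the second claim.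

Two analytic points come first. The functions `X f` and the fields `∇_X Y` are smooth, and
`[X, Y]f = X(Yf) - Y(Xf)`; the latter follows from the Jacobi identity for `X`, `Y`, `f Z`. The
curvature on tangent vectors is defined by particular extensions; independence of the extension
(`curvature_eq_curvatureAt`) and multilinearity follow from the symmetries of the curvature of
fields, because each of the first three arguments can be moved to the last one.
-/

noncomputable section

set_option linter.unusedSectionVars false

namespace SasakiGeometry

/-! ### Vector fields and functions smooth near a point -/

section SmoothGerms
open Filter Topology Module

variable {E : Type*} [NormedAddCommGroup E] [NormedSpace ℝ E]
  {H : Type*} [TopologicalSpace H] {I : ModelWithCorners ℝ E H}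
  {M : Type*} [TopologicalSpace M] [ChartedSpace H M] [IsManifold I ∞ M]

/-- The vector field `X` is smooth on a neighbourhood of `x`. -/
def SmoothNear (X : Π x : M, TangentSpace I x) (x : M) : Prop :=
  ∀ᶠ y in 𝓝 x, ContMDiffAt I (I.prod 𝓘(ℝ, E)) ∞ (T% X) y

variable (I) in
/-- The real function `f` is smooth on a neighbourhood of `x`. -/
def SmoothFunNear (f : M → ℝ) (x : M) : Prop :=
  ∀ᶠ y in 𝓝 x, ContMDiffAt I 𝓘(ℝ) ∞ f y

variable {X Y Z : Π x : M, TangentSpace I x} {f g : M → ℝ} {x : M}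

lemma SmoothNear.contMDiffAt (hX : SmoothNear X x) :
    ContMDiffAt I (I.prod 𝓘(ℝ, E)) ∞ (T% X) x := hX.self_of_nhds

lemma SmoothNear.mdifferentiableAt (hX : SmoothNear X x) : MDiffAt (T% X) x :=
  hX.contMDiffAt.mdifferentiableAt (by simp)

lemma SmoothNear.eventually (hX : SmoothNear X x) : ∀ᶠ y in 𝓝 x, SmoothNear X y :=
  eventually_eventually_nhds.2 hX

lemma SmoothFunNear.contMDiffAt (hf : SmoothFunNear I f x) : ContMDiffAt I 𝓘(ℝ) ∞ f x :=
  hf.self_of_nhds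

lemma SmoothFunNear.mdifferentiableAt (hf : SmoothFunNear I f x) : MDiffAt f x :=
  hf.contMDiffAt.mdifferentiableAt (by simp)

lemma SmoothFunNear.eventually (hf : SmoothFunNear I f x) : ∀ᶠ y in 𝓝 x, SmoothFunNear I f y :=
  eventually_eventually_nhds.2 hf

lemma SmoothField.smoothNear (hX : SmoothField I X) : SmoothNear X x :=
  Eventually.of_forall fun y ↦ hX y

lemma SmoothNear.add (hX : SmoothNear X x) (hY : SmoothNear Y x) :
    SmoothNear (fun y ↦ X y + Y y) x := by
  filter_upwards [hX, hY] with y h1 h2 using h1.add_section h2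

lemma SmoothNear.sub (hX : SmoothNear X x) (hY : SmoothNear Y x) :
    SmoothNear (fun y ↦ X y - Y y) x := by
  filter_upwards [hX, hY] with y h1 h2 using h1.sub_section h2

lemma SmoothNear.smul (hf : SmoothFunNear I f x) (hY : SmoothNear Y x) :
    SmoothNear (fun y ↦ f y • Y y) x := by
  filter_upwards [hf, hY] with y h1 h2 using h1.smul_section h2

lemma SmoothNear.const_smul (c : ℝ) (hY : SmoothNear Y x) :
    SmoothNear (fun y ↦ c • Y y) x := by
  filter_upwards [hY] with y h2 using h2.const_smul_section

lemma smoothNear_extend (v : TangentSpace I x) : SmoothNear (FiberBundle.extend E v) x := by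
  obtain ⟨s, hs, h⟩ := FiberBundle.exists_contMDiffOn_extend (k := ∞) I E v
  filter_upwards [eventually_mem_nhds_iff.2 hs] with y hy using h.contMDiffAt hy

lemma SmoothNear.apply {J : Π x : M, TangentSpace I x →L[ℝ] TangentSpace I x}
    (hX : SmoothNear X x) (hJ : SmoothEndo I J) : SmoothNear (fun y ↦ J y (X y)) x := by
  filter_upwards [hX] with y hy
  exact ContMDiffAt.clm_bundle_apply (F₁ := E) (F₂ := E) (b := fun y ↦ y)
    (E₁ := fun x : M ↦ TangentSpace I x) (E₂ := fun x : M ↦ TangentSpace I x) (hJ y) hy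

lemma mvfderiv_congr (h : f =ᶠ[𝓝 x] g) (v : TangentSpace I x) :
    mvfderiv I f x v = mvfderiv I g x v := by
  have := h.mfderiv_eq (I := I) (I' := 𝓘(ℝ))
  change mfderiv I 𝓘(ℝ) f x v = mfderiv I 𝓘(ℝ) g x v
  rw [this]
  rfl

lemma minSmoothness_nat_le_infty (n : ℕ) : minSmoothness ℝ n ≤ (∞ : ℕ∞ω) := by
  rw [minSmoothness_of_isRCLikeNormedField]
  exact WithTop.coe_le_coe.2 (le_top (a := (n : ℕ∞)))

variable [FiniteDimensional ℝ E]

lemma ContMDiffAt.mlieBracket_top (hX : ContMDiffAt I (I.prod 𝓘(ℝ, E)) ∞ (T% X) x)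
    (hY : ContMDiffAt I (I.prod 𝓘(ℝ, E)) ∞ (T% Y) x) :
    ContMDiffAt I (I.prod 𝓘(ℝ, E)) ∞ (T% (mlieBracket I X Y)) x := by
  have : IsManifold I (minSmoothness ℝ 2) M := by
    exact IsManifold.of_le (n := ∞) (minSmoothness_nat_le_infty 2)
  have : IsManifold I (((⊤ : ℕ∞) : ℕ∞ω) + 1) M := ‹IsManifold I ∞ M›
  exact ContMDiffAt.mlieBracket_vectorField (m := ⊤) (n := ⊤) hX hY (by simp)

lemma SmoothNear.mlieBracket (hX : SmoothNear X x) (hY : SmoothNear Y x) :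
    SmoothNear (mlieBracket I X Y) x := by
  filter_upwards [hX, hY] with y h1 h2 using ContMDiffAt.mlieBracket_top h1 h2

end SmoothGerms

/-! ### Derivatives along fields and smoothness criteria -/

section Regularity
open Filter Topology Module

variable {E : Type*} [NormedAddCommGroup E] [NormedSpace ℝ E] [FiniteDimensional ℝ E]
  {H : Type*} [TopologicalSpace H] {I : ModelWithCorners ℝ E H}
  {M : Type*} [TopologicalSpace M] [ChartedSpace H M] [IsManifold I ∞ M]
  [RiemannianBundle (fun x : M ↦ TangentSpace I x)]
  [IsContMDiffRiemannianBundle I ∞ E (fun x : M ↦ TangentSpace I x)]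

variable {X Y Z : Π x : M, TangentSpace I x} {f g : M → ℝ} {x : M}

lemma contMDiffAt_metricFn (hX : ContMDiffAt I (I.prod 𝓘(ℝ, E)) ∞ (T% X) x)
    (hY : ContMDiffAt I (I.prod 𝓘(ℝ, E)) ∞ (T% Y) x) :
    ContMDiffAt I 𝓘(ℝ) ∞ (metricFn X Y) x :=
  ContMDiffAt.inner_bundle (E := fun x : M ↦ TangentSpace I x) (F := E) (IB := I) (IM := I)
    (b := fun y ↦ y) hX hY

lemma SmoothNear.metricFn (hX : SmoothNear X x) (hY : SmoothNear Y x) :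
    SmoothFunNear I (metricFn X Y) x := by
  filter_upwards [hX, hY] with y h1 h2 using contMDiffAt_metricFn h1 h2

/-- A function `c` is smooth as soon as its product with a nonvanishing vector field is. -/
lemma contMDiffAt_of_smul {c : M → ℝ} (hX : ContMDiffAt I (I.prod 𝓘(ℝ, E)) ∞ (T% X) x)
    (h0 : X x ≠ 0) (h : ContMDiffAt I (I.prod 𝓘(ℝ, E)) ∞ (T% (fun y ↦ c y • X y)) x) :
    ContMDiffAt I 𝓘(ℝ) ∞ c x := by
  have h1 := contMDiffAt_metricFn h hX
  have h2 := contMDiffAt_metricFn hX hX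
  have h3 : metricFn X X x ≠ 0 := by simpa [metricFn] using h0
  have h4 : ∀ᶠ y in 𝓝 x, metricFn X X y ≠ 0 := h2.continuousAt.eventually_ne h3
  refine (h1.div₀ h2 h3).congr_of_eventuallyEq ?_
  filter_upwards [h4] with y hy
  simp only [metricFn, inner_smul_left, Pi.div_apply] at hy ⊢
  field_simp
  simp

variable [Nontrivial E]

lemma exists_ne_zero_tangentSpace (x : M) : ∃ v : TangentSpace I x, v ≠ 0 :=
  exists_ne (0 : E)

/-- The derivative `X f` of a smooth function along a smooth vector field is smooth. It is read off
from `[X, f Z] - f [X, Z] = (X f) Z`. -/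
lemma SmoothFunNear.mvfderiv (hf : SmoothFunNear I f x) (hX : SmoothNear X x) :
    SmoothFunNear I (fun y ↦ mvfderiv I f y (X y)) x := by
  filter_upwards [hf.eventually, hX.eventually] with y hf hX
  obtain ⟨v, hv⟩ := exists_ne_zero_tangentSpace (I := I) y
  have hZ := smoothNear_extend v
  refine contMDiffAt_of_smul hZ.contMDiffAt (by simpa using hv) ?_
  have h1 := ((hX.mlieBracket (hZ.smul hf)).sub ((hX.mlieBracket hZ).smul hf)).contMDiffAt
  refine h1.congr_of_eventuallyEq ?_
  filter_upwards [hf, hZ, hX] with z hf hZ hX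
  have := mlieBracket_smul_right (V := X) (hf.mdifferentiableAt (by simp))
    (hZ.mdifferentiableAt (by simp))
  congr 1
  exact (sub_eq_of_eq_add this).symm

/-- The Lie bracket acts on functions as a commutator; by the Jacobi identity for `X`, `Y`, `f Z`. -/
lemma mvfderiv_mlieBracket (hf : SmoothFunNear I f x) (hX : SmoothNear X x) (hY : SmoothNear Y x) :
    mvfderiv I f x (mlieBracket I X Y x) = mvfderiv I (fun y ↦ mvfderiv I f y (Y y)) x (X x)
      - mvfderiv I (fun y ↦ mvfderiv I f y (X y)) x (Y x) := by
  obtain ⟨v, hv⟩ := exists_ne_zero_tangentSpace (I := I) x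
  have hZ := smoothNear_extend v
  set Z := FiberBundle.extend E v with hZd
  have hm : minSmoothness ℝ 2 ≤ (∞ : ℕ∞ω) := minSmoothness_nat_le_infty 2
  have hm3 : minSmoothness ℝ 3 ≤ (∞ : ℕ∞ω) := minSmoothness_nat_le_infty 3
  have : IsManifold I (minSmoothness ℝ 3) M := IsManifold.of_le (n := ∞) hm3
  have key : ∀ {X Y : Π x : M, TangentSpace I x}, SmoothNear X x → SmoothNear Y x →
      mlieBracket I X (mlieBracket I Y (f • Z)) x
        = mvfderiv I (fun y ↦ mvfderiv I f y (Y y)) x (X x) • Z x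
          + mvfderiv I f x (Y x) • mlieBracket I X Z x
          + mvfderiv I f x (X x) • mlieBracket I Y Z x
          + f x • mlieBracket I X (mlieBracket I Y Z) x := by
    intro X Y hX hY
    have e : mlieBracket I Y (f • Z) =ᶠ[𝓝 x]
        ((fun y ↦ mvfderiv I f y (Y y)) • Z + f • mlieBracket I Y Z) := by
      filter_upwards [hf, hZ, hX] with z hf hZ hX
      exact mlieBracket_smul_right (V := Y) (hf.mdifferentiableAt (by simp))
        (hZ.mdifferentiableAt (by simp))
    rw [(EventuallyEq.refl _ X).mlieBracket_vectorField_eq e,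
      mlieBracket_add_right (W := (fun y ↦ mvfderiv I f y (Y y)) • Z) (W₁ := f • mlieBracket I Y Z)
        (hZ.smul (hf.mvfderiv hY)).mdifferentiableAt
        ((hY.mlieBracket hZ).smul hf).mdifferentiableAt,
      mlieBracket_smul_right (hf.mvfderiv hY).mdifferentiableAt hZ.mdifferentiableAt,
      mlieBracket_smul_right hf.mdifferentiableAt (hY.mlieBracket hZ).mdifferentiableAt]
    module
  have h1 := leibniz_identity_mlieBracket_apply (hX.contMDiffAt.of_le hm)
    (hY.contMDiffAt.of_le hm) ((hZ.smul hf).contMDiffAt.of_le hm)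
  have h2 := leibniz_identity_mlieBracket_apply (hX.contMDiffAt.of_le hm)
    (hY.contMDiffAt.of_le hm) (hZ.contMDiffAt.of_le hm)
  change mlieBracket I X (mlieBracket I Y (f • Z)) x = mlieBracket I (mlieBracket I X Y) (f • Z) x
    + mlieBracket I Y (mlieBracket I X (f • Z)) x at h1
  rw [key hX hY, key hY hX, mlieBracket_smul_right hf.mdifferentiableAt hZ.mdifferentiableAt,
    h2] at h1
  have h3 : (mvfderiv I f x (mlieBracket I X Y x)
      - (mvfderiv I (fun y ↦ mvfderiv I f y (Y y)) x (X x)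
      - mvfderiv I (fun y ↦ mvfderiv I f y (X y)) x (Y x))) • Z x = 0 := by
    rw [← sub_eq_zero] at h1
    rw [← neg_eq_zero, ← h1]
    module
  rcases smul_eq_zero.1 h3 with h | h
  · linarith
  · exact absurd h (by simpa [hZd] using hv)

/-- A section is smooth if its inner products with smooth vector fields are. By Cramer's rule, its
coefficients in a local frame are quotients of determinants of such inner products. -/
lemma contMDiffAt_of_metricFn
    (h : ∀ Z : Π x : M, TangentSpace I x, SmoothNear Z x → ContMDiffAt I 𝓘(ℝ) ∞ (metricFn Z X) x) :
    ContMDiffAt I (I.prod 𝓘(ℝ, E)) ∞ (T% X) x := by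
  classical
  let t := trivializationAt E (fun x : M ↦ TangentSpace I x) x
  have hx : x ∈ t.baseSet := FiberBundle.mem_baseSet_trivializationAt E _ x
  let b := Module.finBasis ℝ E
  let s := t.localFrame b
  have hs (i) : SmoothNear (s i) x := by
    filter_upwards [t.open_baseSet.mem_nhds hx] with y hy using
      contMDiffAt_localFrame_of_mem ∞ _ b i hy
  have det_smooth (A : M → Matrix (Fin (finrank ℝ E)) (Fin (finrank ℝ E)) ℝ)
      (hA : ∀ i j, ContMDiffAt I 𝓘(ℝ) ∞ (fun y ↦ A y i j) x) :
      ContMDiffAt I 𝓘(ℝ) ∞ (fun y ↦ (A y).det) x := by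
    simp only [Matrix.det_apply']
    refine contMDiffAt_finsetSum fun σ _ ↦ ?_
    refine ContMDiffAt.mul contMDiffAt_const (contMDiffAt_finsetProd fun i _ ↦ hA _ _)
  let G : M → Matrix (Fin (finrank ℝ E)) (Fin (finrank ℝ E)) ℝ :=
    fun y ↦ Matrix.gram ℝ fun i ↦ s i y
  let φ : M → Fin (finrank ℝ E) → ℝ := fun y i ↦ metricFn (s i) X y
  have hG : ContMDiffAt I 𝓘(ℝ) ∞ (fun y ↦ (G y).det) x :=
    det_smooth G fun i j ↦ ((hs i).metricFn (hs j)).contMDiffAt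
  have hdet {y} (hy : y ∈ t.baseSet) : (G y).det ≠ 0 :=
    (Matrix.posDef_gram_of_linearIndependent (𝕜 := ℝ)
      ((t.isLocalFrameOn_localFrame_baseSet I ∞ b).linearIndependent hy)).det_pos.ne'
  refine (contMDiffAt_iff_localFrameCoeff (e := t) b hx).2 fun i ↦ ?_
  have hc : ContMDiffAt I 𝓘(ℝ) ∞ (fun y ↦ ((G y).updateCol i (φ y)).det / (G y).det) x := by
    refine ContMDiffAt.div₀ (det_smooth _ fun j k ↦ ?_) hG (hdet hx)
    by_cases hk : k = i
    · subst hk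
      simpa [φ] using h _ (hs j)
    · simp only [ne_eq, hk, not_false_eq_true, Matrix.updateCol_ne]
      exact ((hs j).metricFn (hs k)).contMDiffAt
  refine hc.congr_of_eventuallyEq ?_
  filter_upwards [t.open_baseSet.mem_nhds hx] with y hy
  rw [eq_div_iff (hdet hy)]
  let c : Fin (finrank ℝ E) → ℝ := fun i ↦ t.localFrameCoeff I b i y (X y)
  have hφ : φ y = (G y).mulVec c := by
    ext i
    simp only [φ, metricFn, G, Matrix.mulVec, dotProduct, Matrix.gram_apply]
    rw [t.eq_sum_localFrameCoeff_smul (I := I) (b := b) (s := X) hy, inner_sum]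
    simp only [inner_smul_right, mul_comm]
    rfl
  have := congrFun (Matrix.cramer_eq_adjugate_mulVec (G y) (φ y)) i
  rw [hφ, Matrix.mulVec_mulVec, Matrix.adjugate_mul, ← hφ, Matrix.smul_mulVec, Matrix.one_mulVec,
    Matrix.cramer_apply] at this
  rw [this]
  exact mul_comm _ _

end Regularity

/-! ### The Levi-Civita connection and its curvature -/

section Curvature
open Filter Topology Module

variable {E : Type*} [NormedAddCommGroup E] [NormedSpace ℝ E] [FiniteDimensional ℝ E]
  {H : Type*} [TopologicalSpace H] {I : ModelWithCorners ℝ E H}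
  {M : Type*} [TopologicalSpace M] [ChartedSpace H M] [IsManifold I ∞ M]
  [RiemannianBundle (fun x : M ↦ TangentSpace I x)]
  [IsContMDiffRiemannianBundle I ∞ E (fun x : M ↦ TangentSpace I x)]

variable {X Y Z W : Π x : M, TangentSpace I x} {f g : M → ℝ} {x : M}

lemma nabla_congr (hY : SmoothNear Y x) (hZ : SmoothNear Z x) (h : Y =ᶠ[𝓝 x] Z) :
    nabla I M X Y x = nabla I M X Z x := by
  have := (leviCivita I M).isCovariantDerivativeOnUniv.congr_of_eventuallyEq
    hY.mdifferentiableAt hZ.mdifferentiableAt univ_mem h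
  exact congrArg (fun L : TangentSpace I x →L[ℝ] TangentSpace I x ↦ L (X x)) this

lemma nabla_add (hY : SmoothNear Y x) (hZ : SmoothNear Z x) :
    nabla I M X (fun y ↦ Y y + Z y) x = nabla I M X Y x + nabla I M X Z x := by
  have := (leviCivita I M).isCovariantDerivativeOnUniv.add
    hY.mdifferentiableAt hZ.mdifferentiableAt
  exact congrArg (fun L : TangentSpace I x →L[ℝ] TangentSpace I x ↦ L (X x)) this

lemma nabla_smul (hf : SmoothFunNear I f x) (hY : SmoothNear Y x) :
    nabla I M X (fun y ↦ f y • Y y) x = f x • nabla I M X Y x + mvfderiv I f x (X x) • Y x := by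
  have := (leviCivita I M).isCovariantDerivativeOnUniv.leibniz
    hY.mdifferentiableAt hf.mdifferentiableAt
  exact congrArg (fun L : TangentSpace I x →L[ℝ] TangentSpace I x ↦ L (X x)) this

lemma nabla_const_smul (c : ℝ) (hY : SmoothNear Y x) :
    nabla I M X (fun y ↦ c • Y y) x = c • nabla I M X Y x := by
  have := (leviCivita I M).isCovariantDerivativeOnUniv.smul_const c hY.mdifferentiableAt
  exact congrArg (fun L : TangentSpace I x →L[ℝ] TangentSpace I x ↦ L (X x)) this

lemma nabla_sub (hY : SmoothNear Y x) (hZ : SmoothNear Z x) :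
    nabla I M X (fun y ↦ Y y - Z y) x = nabla I M X Y x - nabla I M X Z x := by
  have h := nabla_add (X := X) hY (hZ.const_smul (-1))
  rw [nabla_const_smul _ hZ] at h
  simpa [sub_eq_add_neg] using h

/-- The Levi-Civita connection is torsion-free. -/
lemma nabla_sub_swap (hX : SmoothNear X x) (hY : SmoothNear Y x) :
    nabla I M X Y x - nabla I M Y X x = mlieBracket I X Y x :=
  leviCivita_sub_swap hX.mdifferentiableAt hY.mdifferentiableAt

/-- The Levi-Civita connection is metric. -/
lemma mvfderiv_metricFn_nabla (hX : SmoothNear X x) (hY : SmoothNear Y x) (hZ : SmoothNear Z x) :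
    mvfderiv I (metricFn Y Z) x (X x)
      = metricFn (nabla I M X Y) Z x + metricFn Y (nabla I M X Z) x :=
  mvfderiv_metricFn hX.mdifferentiableAt hY.mdifferentiableAt hZ.mdifferentiableAt

variable [Nontrivial E]

lemma SmoothFunNear.koszul (hX : SmoothNear X x) (hY : SmoothNear Y x) (hZ : SmoothNear Z x) :
    SmoothFunNear I (koszul X Y Z) x := by
  filter_upwards [(hY.metricFn hZ).mvfderiv hX, (hX.metricFn hZ).mvfderiv hY,
    (hX.metricFn hY).mvfderiv hZ, (hX.mlieBracket hY).metricFn hZ, (hX.mlieBracket hZ).metricFn hY,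
    (hY.mlieBracket hZ).metricFn hX] with y h1 h2 h3 h4 h5 h6
  exact contMDiffAt_const.mul (((((h1.add h2).sub h3).add h4).sub h5).sub h6)

lemma SmoothNear.nabla (hX : SmoothNear X x) (hY : SmoothNear Y x) :
    SmoothNear (nabla I M X Y) x := by
  filter_upwards [hX.eventually, hY.eventually] with y hX hY
  refine contMDiffAt_of_metricFn fun Z hZ ↦ ?_
  refine (SmoothFunNear.koszul hX hY hZ).contMDiffAt.congr_of_eventuallyEq ?_
  filter_upwards [hX, hY, hZ] with z hX hY hZ
  rw [metricFn_comm]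
  exact inner_leviCivita (hX.mdifferentiableAt (by simp)) (hY.mdifferentiableAt (by simp))
    (hZ.mdifferentiableAt (by simp))

lemma curvature_swap (X Y Z : Π x : M, TangentSpace I x) (x : M) :
    curvature (nabla I M) X Y Z x = - curvature (nabla I M) Y X Z x := by
  have : nabla I M (mlieBracket I X Y) Z x = - nabla I M (mlieBracket I Y X) Z x := by
    simp only [nabla, mlieBracket_swap_apply (V := X), map_neg]
  simp only [curvature, this]
  abel

/-- The second derivative of `⟨Z, W⟩` by means of the Levi-Civita connection. -/
lemma mvfderiv_mvfderiv_metricFn (hX : SmoothNear X x) (hY : SmoothNear Y x)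
    (hZ : SmoothNear Z x) (hW : SmoothNear W x) :
    mvfderiv I (fun y ↦ mvfderiv I (metricFn Z W) y (Y y)) x (X x)
      = inner ℝ (nabla I M X (nabla I M Y Z) x) (W x)
        + inner ℝ (nabla I M Y Z x) (nabla I M X W x)
        + inner ℝ (nabla I M X Z x) (nabla I M Y W x)
        + inner ℝ (Z x) (nabla I M X (nabla I M Y W) x) := by
  have e : (fun y ↦ mvfderiv I (metricFn Z W) y (Y y)) =ᶠ[𝓝 x]
      metricFn (nabla I M Y Z) W + metricFn Z (nabla I M Y W) := by
    filter_upwards [hY.eventually, hZ.eventually, hW.eventually] with y hY hZ hW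
      using mvfderiv_metricFn_nabla hY hZ hW
  rw [mvfderiv_congr e, mvfderiv_add ((hY.nabla hZ).metricFn hW).mdifferentiableAt
    (hZ.metricFn (hY.nabla hW)).mdifferentiableAt, add_apply,
    mvfderiv_metricFn_nabla hX (hY.nabla hZ) hW, mvfderiv_metricFn_nabla hX hZ (hY.nabla hW)]
  simp only [metricFn]
  ring

/-- `Rm(X, Y)` is skew-symmetric, since `[X, Y]` acts on `⟨Z, W⟩` as a commutator. -/
lemma curvature_skew (hX : SmoothNear X x) (hY : SmoothNear Y x)
    (hZ : SmoothNear Z x) (hW : SmoothNear W x) :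
    inner ℝ (curvature (nabla I M) X Y Z x) (W x)
      = - inner ℝ (curvature (nabla I M) X Y W x) (Z x) := by
  have h1 := mvfderiv_mlieBracket (hZ.metricFn hW) hX hY
  rw [mvfderiv_metricFn_nabla (hX.mlieBracket hY) hZ hW, mvfderiv_mvfderiv_metricFn hX hY hZ hW,
    mvfderiv_mvfderiv_metricFn hY hX hZ hW] at h1
  simp only [metricFn] at h1
  simp only [curvature, inner_sub_left, inner_sub_right, real_inner_comm (Z x)]
  linarith

/-- The first Bianchi identity. -/
lemma curvature_bianchi (hX : SmoothNear X x) (hY : SmoothNear Y x) (hZ : SmoothNear Z x) :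
    curvature (nabla I M) X Y Z x + curvature (nabla I M) Y Z X x
      + curvature (nabla I M) Z X Y x = 0 := by
  -- one torsion-free cyclic term; the sum of the three is the Jacobi identity
  have key : ∀ {X Y Z : Π x : M, TangentSpace I x}, SmoothNear X x → SmoothNear Y x →
      SmoothNear Z x → nabla I M X (nabla I M Y Z) x - nabla I M X (nabla I M Z Y) x
        - nabla I M (mlieBracket I Y Z) X x = mlieBracket I X (mlieBracket I Y Z) x := by
    intro X Y Z hX hY hZ
    rw [← nabla_sub (hY.nabla hZ) (hZ.nabla hY), ← nabla_sub_swap hX (hY.mlieBracket hZ)]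
    congr 1
    refine nabla_congr ((hY.nabla hZ).sub (hZ.nabla hY)) (hY.mlieBracket hZ) ?_
    filter_upwards [hY.eventually, hZ.eventually] with y hY hZ using nabla_sub_swap hY hZ
  have : IsManifold I (minSmoothness ℝ 3) M :=
    IsManifold.of_le (n := ∞) (minSmoothness_nat_le_infty 3)
  have hm := minSmoothness_nat_le_infty 2
  have h := leibniz_identity_mlieBracket_apply (hX.contMDiffAt.of_le hm)
    (hY.contMDiffAt.of_le hm) (hZ.contMDiffAt.of_le hm)
  have hs : mlieBracket I Y (mlieBracket I X Z) x = - mlieBracket I Y (mlieBracket I Z X) x := by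
    rw [mlieBracket_swap (V := X) (W := Z), ← neg_one_smul ℝ (mlieBracket I Z X),
      mlieBracket_const_smul_right (hZ.mlieBracket hX).mdifferentiableAt, neg_one_smul]
  rw [hs, mlieBracket_swap_apply (V := mlieBracket I X Y)] at h
  have h1 := key hX hY hZ
  have h2 := key hY hZ hX
  have h3 := key hZ hX hY
  rw [h, ← h2, ← h3] at h1
  simp only [curvature]
  rw [← sub_eq_zero] at h1
  rw [← h1]
  abel

/-- The pair symmetry is a combination of the four Bianchi identities for `X`, `Y`, `Z`, `W`. -/
lemma curvature_pair_symm (hX : SmoothNear X x) (hY : SmoothNear Y x)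
    (hZ : SmoothNear Z x) (hW : SmoothNear W x) :
    inner ℝ (curvature (nabla I M) X Y Z x) (W x)
      = inner ℝ (curvature (nabla I M) Z W X x) (Y x) := by
  have b : ∀ {X Y Z W : Π x : M, TangentSpace I x}, SmoothNear X x → SmoothNear Y x →
      SmoothNear Z x → inner ℝ (curvature (nabla I M) X Y Z x) (W x)
        + inner ℝ (curvature (nabla I M) Y Z X x) (W x)
        + inner ℝ (curvature (nabla I M) Z X Y x) (W x) = 0 := by
    intro X Y Z W hX hY hZ
    rw [← inner_add_left, ← inner_add_left, curvature_bianchi hX hY hZ, inner_zero_left]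
  have s : ∀ (X Y Z W : Π x : M, TangentSpace I x),
      inner ℝ (curvature (nabla I M) X Y Z x) (W x)
        = - inner ℝ (curvature (nabla I M) Y X Z x) (W x) := by
    intro X Y Z W
    rw [curvature_swap, inner_neg_left]
  linarith [b (W := W) hX hY hZ, b (W := X) hY hZ hW, b (W := Y) hZ hW hX, b (W := Z) hW hX hY,
    curvature_skew hX hY hZ hW, curvature_skew hY hZ hX hW, curvature_skew hZ hX hY hW,
    curvature_skew hY hZ hW hX, curvature_skew hZ hW hY hX, curvature_skew hW hY hZ hX,
    curvature_skew hZ hW hX hY, curvature_skew hW hX hZ hY, curvature_skew hX hZ hW hY,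
    curvature_skew hW hX hY hZ, curvature_skew hX hY hW hZ, curvature_skew hY hW hX hZ,
    s X Z W Y, s Y W X Z, s Z X W Y, s W Y X Z, s X Y Z W, s Z W X Y, s Y X Z W, s W Z X Y]

/-- The curvature at `x` depends only on the values of the fields at `x`. This follows from its
symmetries alone, since each argument can be moved into the inner product. -/
lemma curvature_eq_curvatureAt (hX : SmoothNear X x) (hY : SmoothNear Y x) (hZ : SmoothNear Z x) :
    curvature (nabla I M) X Y Z x = curvatureAt (nabla I M) (X x) (Y x) (Z x) := by
  refine ext_inner_right ℝ fun w ↦ ?_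
  have hX' := smoothNear_extend (X x)
  have hY' := smoothNear_extend (Y x)
  have hZ' := smoothNear_extend (Z x)
  have hW' := smoothNear_extend w
  set X' := FiberBundle.extend E (X x) with hXd
  set Y' := FiberBundle.extend E (Y x) with hYd
  set Z' := FiberBundle.extend E (Z x) with hZd
  set W' := FiberBundle.extend E w with hWd
  have eX : X x = X' x := by simp [hXd]
  have eY : Y x = Y' x := by simp [hYd]
  have eZ : Z x = Z' x := by simp [hZd]
  have eW : w = W' x := by simp [hWd]
  change _ = inner ℝ (curvature (nabla I M) X' Y' Z' x) w
  rw [eW, curvature_skew hX hY hZ hW', eZ, ← curvature_skew hX hY hZ' hW',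
    curvature_pair_symm hX hY hZ' hW', eY, ← curvature_pair_symm hX hY' hZ' hW', curvature_swap,
    inner_neg_left, curvature_pair_symm hY' hX hZ' hW', eX,
    ← curvature_pair_symm hY' hX' hZ' hW', ← inner_neg_left, ← curvature_swap]

/-- The Riemann curvature tensor `⟨Rm(u, v)w, z⟩`. -/
def riem {x : M} (u v w z : TangentSpace I x) : ℝ := inner ℝ (curvatureAt (nabla I M) u v w) z

lemma riem_skew (u v w z : TangentSpace I x) : riem u v w z = - riem u v z w := by
  simpa [riem, curvatureAt] using curvature_skew (smoothNear_extend u) (smoothNear_extend v)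
    (smoothNear_extend w) (smoothNear_extend z)

lemma riem_pair_symm (u v w z : TangentSpace I x) : riem u v w z = riem w z u v := by
  simpa [riem, curvatureAt] using curvature_pair_symm (smoothNear_extend u) (smoothNear_extend v)
    (smoothNear_extend w) (smoothNear_extend z)

lemma riem_add_right (u v w z z' : TangentSpace I x) :
    riem u v w (z + z') = riem u v w z + riem u v w z' := inner_add_right ..

lemma riem_smul_right (c : ℝ) (u v w z : TangentSpace I x) :
    riem u v w (c • z) = c * riem u v w z := real_inner_smul_right ..

lemma riem_add_third (u v w w' z : TangentSpace I x) :
    riem u v (w + w') z = riem u v w z + riem u v w' z := by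
  rw [riem_skew, riem_add_right, riem_skew u v z w, riem_skew u v z w']; ring

lemma riem_smul_third (c : ℝ) (u v w z : TangentSpace I x) :
    riem u v (c • w) z = c * riem u v w z := by
  rw [riem_skew, riem_smul_right, riem_skew u v z w]; ring

lemma riem_add_second (u v v' w z : TangentSpace I x) :
    riem u (v + v') w z = riem u v w z + riem u v' w z := by
  rw [riem_pair_symm, riem_add_right, riem_pair_symm w, riem_pair_symm w]

lemma riem_smul_second (c : ℝ) (u v w z : TangentSpace I x) :
    riem u (c • v) w z = c * riem u v w z := by
  rw [riem_pair_symm, riem_smul_right, riem_pair_symm w]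

lemma riem_add_left (u u' v w z : TangentSpace I x) :
    riem (u + u') v w z = riem u v w z + riem u' v w z := by
  rw [riem_pair_symm, riem_add_third, riem_pair_symm w, riem_pair_symm w]

lemma riem_smul_left (c : ℝ) (u v w z : TangentSpace I x) :
    riem (c • u) v w z = c * riem u v w z := by
  rw [riem_pair_symm, riem_smul_third, riem_pair_symm w]

end Curvature

/-! ### The algebra of the Nijenhuis equation -/

/-- The algebra behind the vanishing of `∇J` on a Kähler manifold: a form `b u v w`, skew in `v`
and `w`, with vanishing cyclic sums, compatible with `J`, and with vanishing Nijenhuis expression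
is zero on the range of `J`. -/
lemma eq_zero_of_cyclic_of_nijenhuis {V : Type*} (J : V → V) (b : V → V → V → ℝ)
    (skew : ∀ u v w, b u v w = - b u w v)
    (cyc : ∀ u v w, b u v w + b v w u + b w u v = 0)
    (hJ : ∀ u v w, b u (J v) w = b u v (J w))
    (hN : ∀ u v w, b (J u) v w - b (J v) u w - b v u (J w) + b u v (J w) = 0) (u v w : V) :
    b u v (J w) = 0 := by
  linarith [hN v w u, cyc (J v) w u, cyc (J w) v u, skew w (J u) v, skew v (J u) w, hJ u v w,
    hJ u w v, skew u (J v) w, skew u (J w) v, hJ w u v, hJ v u w, hJ w v u, hJ v w u,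
    skew u v (J w), skew u w (J v), skew w v (J u), skew v w (J u)]

section Sasakian
open Filter Topology Module

variable {E : Type*} [NormedAddCommGroup E] [NormedSpace ℝ E] [FiniteDimensional ℝ E]
  {H : Type*} [TopologicalSpace H] {I : ModelWithCorners ℝ E H}
  {M : Type*} [TopologicalSpace M] [ChartedSpace H M] [IsManifold I ∞ M]
  [RiemannianBundle (fun x : M ↦ TangentSpace I x)]
  [IsContMDiffRiemannianBundle I ∞ E (fun x : M ↦ TangentSpace I x)]

variable {X Y Z W : Π x : M, TangentSpace I x} {x : M}
  {J : Π x : M, TangentSpace I x →L[ℝ] TangentSpace I x}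
  {R : Π x : M, TangentSpace I x} {α : Π x : M, TangentSpace I x →L[ℝ] ℝ}

/-! ### Contact metric structures at a point -/

namespace IsContactMetric

lemma inner_J_right (h : IsContactMetric J R α) (u v : TangentSpace I x) :
    inner ℝ u (J x v) = - inner ℝ (J x u) v := by
  rw [h.inner_eq, real_inner_comm, h.inner_eq, oneFormDAt, oneFormD_swap, oneFormDAt]

lemma inner_J_self (h : IsContactMetric J R α) (u : TangentSpace I x) :
    inner ℝ (J x u) u = 0 := by
  have := h.inner_J_right u u
  rw [real_inner_comm] at this
  linarith

lemma inner_R_J (h : IsContactMetric J R α) (v : TangentSpace I x) :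
    inner ℝ (R x) (J x v) = 0 := by
  rw [h.inner_J_right, h.J_R, inner_zero_left, neg_zero]

/-- The Reeb field is the unit normal of `D`. It is orthogonal to `D` because `J` maps `D` onto
itself and `⟨R, Jw⟩ = dα(R, w) = 0`. -/
lemma inner_R_left (h : IsContactMetric J R α) (v : TangentSpace I x) : inner ℝ (R x) v = α x v := by
  have hD : v - α x v • R x ∈ distribution α x := by
    simp [distribution, h.form_R]
  have h1 : inner ℝ (R x) (v - α x v • R x) = 0 := by
    rw [← neg_neg (v - α x v • R x), ← h.sq x _ hD, inner_neg_right, h.inner_R_J, neg_zero]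
  rw [inner_sub_right, inner_smul_right, h.inner_R] at h1
  simpa [sub_eq_zero] using h1

lemma form_J (h : IsContactMetric J R α) (v : TangentSpace I x) : α x (J x v) = 0 := by
  rw [← h.inner_R_left, h.inner_R_J]

lemma J_J (h : IsContactMetric J R α) (v : TangentSpace I x) :
    J x (J x v) = - v + α x v • R x := by
  have hD : v - α x v • R x ∈ distribution α x := by
    simp [distribution, h.form_R]
  have h1 := h.sq x _ hD
  rw [map_sub, map_smul, h.J_R, smul_zero, sub_zero] at h1
  rw [h1]
  abel

lemma inner_J_J (h : IsContactMetric J R α) (u v : TangentSpace I x) :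
    inner ℝ (J x u) (J x v) = inner ℝ u v - α x u * α x v := by
  rw [h.inner_J_right, h.J_J, inner_add_left, inner_neg_left, real_inner_smul_left, h.inner_R_left]
  ring

lemma smoothNear_R (h : IsContactMetric J R α) : SmoothNear R x := h.smooth_R.smoothNear

lemma form_apply (h : IsContactMetric J R α) (X : Π x : M, TangentSpace I x) :
    (fun y ↦ α y (X y)) = metricFn R X := by
  ext y
  exact (h.inner_R_left _).symm

/-! ### The covariant derivative of the Reeb field -/

/-- `dα` is twice the skew-symmetric part of `∇R`. -/
lemma inner_J_eq_nabla (h : IsContactMetric J R α) (hX : SmoothNear X x) (hY : SmoothNear Y x) :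
    inner ℝ (X x) (J x (Y x))
      = inner ℝ (nabla I M X R x) (Y x) - inner ℝ (nabla I M Y R x) (X x) := by
  rw [h.inner_eq, oneFormDAt_apply h.contact.smooth hX.mdifferentiableAt hY.mdifferentiableAt,
    oneFormD, h.form_apply, h.form_apply, mvfderiv_metricFn_nabla hX h.smoothNear_R hY,
    mvfderiv_metricFn_nabla hY h.smoothNear_R hX, ← h.inner_R_left, ← nabla_sub_swap hX hY,
    inner_sub_right]
  simp only [metricFn]
  ring

lemma inner_J_eq (h : IsContactMetric J R α) (u v : TangentSpace I x) :
    inner ℝ u (J x v) = inner ℝ (leviCivita I M R x u) v - inner ℝ (leviCivita I M R x v) u := by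
  simpa [nabla] using h.inner_J_eq_nabla (smoothNear_extend u) (smoothNear_extend v)

lemma inner_nabla_R_R (h : IsContactMetric J R α) (u : TangentSpace I x) :
    inner ℝ (leviCivita I M R x u) (R x) = 0 := by
  have h1 := mvfderiv_metricFn_nabla (smoothNear_extend u) h.smoothNear_R h.smoothNear_R
  have e : metricFn R R = fun _ ↦ (1 : ℝ) := by
    ext y
    exact h.toIsAlmostContactMetric.inner_R y
  rw [e, mvfderiv_const] at h1
  simp only [metricFn, nabla, FiberBundle.extend_apply_self, real_inner_comm (R x),
    zero_apply] at h1
  rw [real_inner_comm] at h1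
  linarith

lemma nabla_R_R (h : IsContactMetric J R α) : leviCivita I M R x (R x) = 0 := by
  refine ext_inner_right ℝ fun v ↦ ?_
  have := h.inner_J_eq (R x) v
  rw [h.inner_nabla_R_R, h.inner_R_J] at this
  rw [inner_zero_left]
  linarith

end IsContactMetric

/-! ### The covariant derivative of `J` -/

/-- The vector field `(∇_X J) Y = ∇_X (J Y) - J (∇_X Y)`. -/
def nablaEndo (J : Π x : M, TangentSpace I x →L[ℝ] TangentSpace I x)
    (X Y : Π x : M, TangentSpace I x) (x : M) : TangentSpace I x :=
  nabla I M X (fun y ↦ J y (Y y)) x - J x (nabla I M X Y x)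

/-- The Nijenhuis tensor in terms of `∇J`, for the torsion-free connection `∇`. -/
lemma nijenhuis_eq_nablaEndo (hJ : SmoothEndo I J) (hX : SmoothNear X x) (hY : SmoothNear Y x) :
    nijenhuis J X Y x = nablaEndo J (fun y ↦ J y (X y)) Y x - nablaEndo J (fun y ↦ J y (Y y)) X x
      + J x (nablaEndo J Y X x) - J x (nablaEndo J X Y x) := by
  have hJX := hX.apply hJ
  have hJY := hY.apply hJ
  simp only [nijenhuis, nablaEndo, ← nabla_sub_swap hX hY, ← nabla_sub_swap hJX hY,
    ← nabla_sub_swap hX hJY, ← nabla_sub_swap hJX hJY, map_sub]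
  abel

namespace IsContactMetric

lemma nablaEndo_skew (h : IsContactMetric J R α) (hX : SmoothNear X x) (hY : SmoothNear Y x)
    (hZ : SmoothNear Z x) :
    inner ℝ (nablaEndo J X Y x) (Z x) = - inner ℝ (nablaEndo J X Z x) (Y x) := by
  have e : metricFn (fun y ↦ J y (Y y)) Z = - metricFn Y (fun y ↦ J y (Z y)) := by
    ext y
    simp [metricFn, h.inner_J_right]
  have h1 := mvfderiv_metricFn_nabla hX (hY.apply h.smooth_J) hZ
  rw [e, mvfderiv_neg, neg_apply, mvfderiv_metricFn_nabla hX hY (hZ.apply h.smooth_J)] at h1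
  simp only [metricFn, h.inner_J_right] at h1
  simp only [nablaEndo, inner_sub_left]
  linarith [h.inner_J_right (nabla I M X Z x) (Y x), real_inner_comm (nabla I M X Z x) (J x (Y x)),
    real_inner_comm (nabla I M X (fun y ↦ J y (Z y)) x) (Y x)]

/-- `∇J` is a tensor, by skew-symmetry of `∇_X J`. -/
lemma nablaEndo_congr (h : IsContactMetric J R α) {X' Y' : Π x : M, TangentSpace I x}
    (hX' : SmoothNear X' x) (hY : SmoothNear Y x) (hY' : SmoothNear Y' x)
    (hXX' : X x = X' x) (hYY' : Y x = Y' x) : nablaEndo J X Y x = nablaEndo J X' Y' x := by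
  have e : nablaEndo J X Y x = nablaEndo J X' Y x := by
    simp only [nablaEndo, nabla, hXX']
  rw [e]
  refine ext_inner_right ℝ fun w ↦ ?_
  have hW := smoothNear_extend w
  have h1 := h.nablaEndo_skew hX' hY hW
  have h2 := h.nablaEndo_skew hX' hY' hW
  rw [FiberBundle.extend_apply_self] at h1 h2
  rw [h1, h2, hYY']

lemma nablaEndo_R (h : IsContactMetric J R α) :
    nablaEndo J X R x = - J x (leviCivita I M R x (X x)) := by
  have e : (fun y ↦ J y (R y)) = fun y ↦ (0 : ℝ) • R y := by
    ext y
    rw [h.J_R, zero_smul]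
  rw [nablaEndo, e, nabla_const_smul _ h.smoothNear_R, zero_smul, zero_sub]
  rfl

variable [Nontrivial E]

/-- The form `⟨·, J ·⟩ = dα` is closed. -/
lemma nablaEndo_cyclic (h : IsContactMetric J R α) (hX : SmoothNear X x) (hY : SmoothNear Y x)
    (hZ : SmoothNear Z x) :
    inner ℝ (nablaEndo J X Y x) (Z x) + inner ℝ (nablaEndo J Y Z x) (X x)
      + inner ℝ (nablaEndo J Z X x) (Y x) = 0 := by
  have hR := h.smoothNear_R (x := x)
  -- the derivative of `⟨Z, J Y⟩ = ⟨∇_Z R, Y⟩ - ⟨∇_Y R, Z⟩` along `X`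
  have key : ∀ {X Y Z : Π x : M, TangentSpace I x}, SmoothNear X x → SmoothNear Y x →
      SmoothNear Z x → inner ℝ (nablaEndo J X Y x) (Z x)
        = inner ℝ (nabla I M X (nabla I M Z R) x - nabla I M (nabla I M X Z) R x) (Y x)
          - inner ℝ (nabla I M X (nabla I M Y R) x - nabla I M (nabla I M X Y) R x) (Z x) := by
    intro X Y Z hX hY hZ
    have e : metricFn Z (fun y ↦ J y (Y y)) =ᶠ[𝓝 x]
        metricFn (nabla I M Z R) Y - metricFn (nabla I M Y R) Z := by
      filter_upwards [hY.eventually, hZ.eventually] with y hY hZ using h.inner_J_eq_nabla hZ hY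
    have h1 := mvfderiv_congr e (X x)
    rw [mvfderiv_sub ((hZ.nabla hR).metricFn hY).mdifferentiableAt
      ((hY.nabla hR).metricFn hZ).mdifferentiableAt, sub_apply,
      mvfderiv_metricFn_nabla hX hZ (hY.apply h.smooth_J),
      mvfderiv_metricFn_nabla hX (hZ.nabla hR) hY, mvfderiv_metricFn_nabla hX (hY.nabla hR) hZ] at h1
    have h2 := h.inner_J_eq_nabla (hX.nabla hZ) hY
    have h3 := h.inner_J_eq_nabla hZ (hX.nabla hY)
    simp only [metricFn] at h1
    rw [real_inner_comm]
    simp only [nablaEndo, inner_sub_left, inner_sub_right]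
    linarith
  have b := congrArg (fun v ↦ inner ℝ v (R x)) (curvature_bianchi hX hY hZ)
  simp only [inner_add_left, inner_zero_left, curvature_skew hX hY hZ hR,
    curvature_skew hY hZ hX hR, curvature_skew hZ hX hY hR] at b
  have l : ∀ {X Y : Π x : M, TangentSpace I x}, SmoothNear X x → SmoothNear Y x →
      nabla I M (mlieBracket I X Y) R x
        = nabla I M (nabla I M X Y) R x - nabla I M (nabla I M Y X) R x := by
    intro X Y hX hY
    simp only [nabla, ← map_sub]
    congr 1
    exact (nabla_sub_swap hX hY).symm
  simp only [curvature, l hX hY, l hY hZ, l hZ hX, inner_sub_left] at b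
  rw [key hX hY hZ, key hY hZ hX, key hZ hX hY]
  simp only [inner_sub_left]
  linarith

end IsContactMetric

namespace IsSasakian

variable [Nontrivial E]

lemma nablaEndo_nijenhuis (h : IsSasakian J R α) (hX : SmoothNear X x) (hY : SmoothNear Y x) :
    nablaEndo J (fun y ↦ J y (X y)) Y x - nablaEndo J (fun y ↦ J y (Y y)) X x
      + J x (nablaEndo J Y X x) - J x (nablaEndo J X Y x) + inner ℝ (X x) (J x (Y x)) • R x = 0 := by
  have h1 := h.normal x (X x) (Y x)
  rwa [nijenhuisAt_apply h.smooth_J hX.mdifferentiableAt hY.mdifferentiableAt,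
    nijenhuis_eq_nablaEndo h.smooth_J hX hY, ← h.inner_eq] at h1

/-- On a Sasakian manifold `∇_v R = - 1/2 J v`; in particular `R` is a Killing field. Normality for
the pair `(X, R)` and closedness of `dα` leave no room for a symmetric part of `∇R`. -/
lemma nabla_R (h : IsSasakian J R α) (v : TangentSpace I x) :
    leviCivita I M R x v = (-1 / 2 : ℝ) • J x v := by
  have hc := h.toIsContactMetric
  have hR := hc.smoothNear_R (x := x)
  set A := leviCivita I M R x
  -- the derivative of `J` along `R`
  have hE : ∀ v : TangentSpace I x, nablaEndo J R (FiberBundle.extend E v) x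
      = - J x (A v) - A (J x v) - J x (J x v) := by
    intro v
    refine ext_inner_right ℝ fun w ↦ ?_
    have hV := smoothNear_extend v
    have hW := smoothNear_extend w
    have h1 := hc.nablaEndo_cyclic hR hV hW
    rw [hc.nablaEndo_skew hV hW hR, hc.nablaEndo_R, hc.nablaEndo_R] at h1
    simp only [FiberBundle.extend_apply_self, inner_neg_left] at h1
    have h2 := hc.inner_J_eq w (J x v)
    have h3 := hc.inner_J_right (A w) v
    rw [real_inner_comm] at h2
    simp only [inner_sub_left, inner_neg_left]
    linarith
  -- normality gives `J A J = 1/2 J`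
  have hN : ∀ v : TangentSpace I x, J x (A (J x v)) = (1 / 2 : ℝ) • J x v := by
    intro v
    have hV := smoothNear_extend v
    have h1 := h.nablaEndo_nijenhuis hV hR
    have e : nablaEndo J (fun y ↦ J y (R y)) (FiberBundle.extend E v) x = 0 := by
      simp only [nablaEndo, nabla, h.J_R, map_zero, sub_zero]
    rw [e, hE, hc.nablaEndo_R, hc.nablaEndo_R, h.J_R, inner_zero_right, zero_smul] at h1
    simp only [FiberBundle.extend_apply_self, map_sub, map_neg] at h1
    rw [hc.J_J v, map_add, map_smul, h.J_R, map_neg, smul_zero] at h1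
    have h2 : (2 : ℝ) • J x (A (J x v)) = J x v := by
      rw [← sub_eq_zero, ← neg_eq_zero, ← h1]
      module
    calc J x (A (J x v)) = (1 / 2 : ℝ) • (2 : ℝ) • J x (A (J x v)) := by module
      _ = _ := by rw [h2]
  -- `∇R` takes values in `D`, where `J` is injective
  have hAJ : ∀ v : TangentSpace I x, A (J x v) = (-1 / 2 : ℝ) • J x (J x v) := by
    intro v
    have h1 := congrArg (J x) (hN v)
    have h2 : α x (A (J x v)) = 0 := by
      rw [← hc.inner_R_left, real_inner_comm]
      exact hc.inner_nabla_R_R _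
    rw [hc.J_J, h2, zero_smul, add_zero, map_smul] at h1
    rw [← neg_neg (A _), h1]
    module
  have h1 := hAJ (J x v)
  rw [hc.J_J v, map_add, map_smul, hc.nabla_R_R, smul_zero, add_zero, map_neg, map_add, map_smul,
    h.J_R, map_neg] at h1
  rw [← neg_neg (A v), h1]
  module

lemma nabla_R_eq (h : IsSasakian J R α) (X : Π x : M, TangentSpace I x) :
    nabla I M X R = fun y ↦ (-1 / 2 : ℝ) • J y (X y) :=
  funext fun _ ↦ h.nabla_R _

/-- The derivative of `J² = -1 + α ⊗ R`. -/
lemma nablaEndo_J (h : IsSasakian J R α) (hX : SmoothNear X x) (hY : SmoothNear Y x) :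
    nablaEndo J X (fun y ↦ J y (Y y)) x + J x (nablaEndo J X Y x)
      = (-1 / 2 : ℝ) • (inner ℝ (J x (X x)) (Y x) • R x + α x (Y x) • J x (X x)) := by
  have hc := h.toIsContactMetric
  have hR := hc.smoothNear_R (x := x)
  have e : (fun y ↦ J y (J y (Y y))) = fun y ↦ metricFn R Y y • R y - Y y := by
    ext y
    rw [hc.J_J, ← hc.inner_R_left, metricFn]
    abel
  simp only [nablaEndo]
  rw [e, nabla_sub (hR.smul (hR.metricFn hY)) hY, nabla_smul (hR.metricFn hY) hR,
    mvfderiv_metricFn_nabla hX hR hY, h.nabla_R_eq, map_sub, hc.J_J]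
  simp only [metricFn, hc.inner_R_left, real_inner_smul_left]
  module

/-- The Sasakian identity `(∇_X J) Y = 1/2 (⟨X, Y⟩ R - α(Y) X)`. -/
lemma nablaEndo_eq (h : IsSasakian J R α) (hX : SmoothNear X x) (hY : SmoothNear Y x) :
    nablaEndo J X Y x = (1 / 2 : ℝ) • (inner ℝ (X x) (Y x) • R x - α x (Y x) • X x) := by
  have hc := h.toIsContactMetric
  have hR := hc.smoothNear_R (x := x)
  let B : TangentSpace I x → TangentSpace I x → TangentSpace I x :=
    fun u v ↦ nablaEndo J (FiberBundle.extend E u) (FiberBundle.extend E v) x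
  have hB : ∀ {X Y : Π x : M, TangentSpace I x}, SmoothNear X x → SmoothNear Y x →
      nablaEndo J X Y x = B (X x) (Y x) := fun _ hY ↦
    hc.nablaEndo_congr (smoothNear_extend _) hY (smoothNear_extend _) (by simp) (by simp)
  -- the difference of the two sides, as a trilinear form
  let b : TangentSpace I x → TangentSpace I x → TangentSpace I x → ℝ := fun u v w ↦
    inner ℝ (B u v) w - (1 / 2 : ℝ) * (inner ℝ u v * α x w - α x v * inner ℝ u w)
  have skewB : ∀ u v w, inner ℝ (B u v) w = - inner ℝ (B u w) v := fun u v w ↦ by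
    simpa [B] using hc.nablaEndo_skew (smoothNear_extend u) (smoothNear_extend v)
      (smoothNear_extend w)
  have skew : ∀ u v w, b u v w = - b u w v := fun u v w ↦ by
    simp only [b, skewB u v w]
    ring
  have cyc : ∀ u v w, b u v w + b v w u + b w u v = 0 := fun u v w ↦ by
    have := hc.nablaEndo_cyclic (smoothNear_extend u) (smoothNear_extend v) (smoothNear_extend w)
    simp only [FiberBundle.extend_apply_self] at this
    simp only [b, B]
    rw [real_inner_comm u v, real_inner_comm u w, real_inner_comm v w]
    linarith
  have hJ : ∀ u v w, b u (J x v) w = b u v (J x w) := fun u v w ↦ by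
    have hV := smoothNear_extend v
    have h1 := h.nablaEndo_J (smoothNear_extend u) hV
    rw [hB (smoothNear_extend u) (hV.apply h.smooth_J), hB (smoothNear_extend u) hV] at h1
    simp only [FiberBundle.extend_apply_self] at h1
    have h2 := congrArg (fun z ↦ inner ℝ z w) h1
    simp only [inner_add_left, real_inner_smul_left, hc.inner_R_left] at h2
    simp only [b, hc.inner_J_right, hc.form_J]
    linarith
  have hN : ∀ u v w, b (J x u) v w - b (J x v) u w - b v u (J x w) + b u v (J x w) = 0 :=
      fun u v w ↦ by
    have hU := smoothNear_extend u
    have hV := smoothNear_extend v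
    have h1 := h.nablaEndo_nijenhuis hU hV
    rw [hB (hU.apply h.smooth_J) hV, hB (hV.apply h.smooth_J) hU, hB hU hV, hB hV hU] at h1
    simp only [FiberBundle.extend_apply_self] at h1
    have h2 := congrArg (fun z ↦ inner ℝ z w) h1
    simp only [inner_add_left, inner_sub_left, real_inner_smul_left, hc.inner_R_left, hc.inner_J_right,
      inner_zero_left] at h2
    have h3 := hc.inner_J_right v u
    rw [real_inner_comm] at h3
    simp only [b, hc.inner_J_right, hc.form_J]
    rw [h3] at h2 ⊢
    linarith
  have hbR : ∀ u v, b u v (R x) = 0 := fun u v ↦ by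
    rw [skew]
    have h1 : B u (R x) = (1 / 2 : ℝ) • J x (J x u) := by
      have := hc.nablaEndo_R (X := FiberBundle.extend E u) (x := x)
      rw [hB (smoothNear_extend u) hR, h.nabla_R, map_smul, FiberBundle.extend_apply_self] at this
      rw [this]
      module
    simp only [b, h1, hc.J_J, h.form_R, real_inner_smul_left, inner_add_left, inner_neg_left,
      hc.inner_R_left, real_inner_comm (R x) u]
    ring
  have hb : ∀ u v w, b u v w = 0 := fun u v w ↦ by
    have h1 := eq_zero_of_cyclic_of_nijenhuis (J x) b skew cyc hJ hN u v (J x w)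
    have h2 := hbR u v
    rw [hc.J_J] at h1
    simp only [b, inner_add_right, inner_neg_right, inner_smul_right, map_add, map_neg, map_smul,
      smul_eq_mul] at h1 h2 ⊢
    linear_combination -h1 + α x w * h2
  rw [hB hX hY]
  refine ext_inner_right ℝ fun w ↦ ?_
  have := hb (X x) (Y x) w
  simp only [b] at this
  simp only [real_inner_smul_left, inner_sub_left, hc.inner_R_left]
  linarith

/-- `Rm(u, v)R = 1/4 (α(v) u - α(u) v)`. -/
lemma riem_R (h : IsSasakian J R α) (u v w : TangentSpace I x) :
    riem u v (R x) w = 1 / 4 * (α x v * inner ℝ u w - α x u * inner ℝ v w) := by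
  have hc := h.toIsContactMetric
  have hR := hc.smoothNear_R (x := x)
  have hU := smoothNear_extend u
  have hV := smoothNear_extend v
  have e := curvature_eq_curvatureAt hU hV hR
  simp only [FiberBundle.extend_apply_self] at e
  have hUV := h.nablaEndo_eq hU hV
  have hVU := h.nablaEndo_eq hV hU
  rw [riem, ← e, curvature, h.nabla_R_eq, h.nabla_R_eq, h.nabla_R_eq,
    nabla_const_smul _ (hV.apply h.smooth_J), nabla_const_smul _ (hU.apply h.smooth_J)]
  simp only [nablaEndo, sub_eq_iff_eq_add] at hUV hVU
  rw [hUV, hVU]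
  beta_reduce
  rw [← nabla_sub_swap hU hV]
  simp only [FiberBundle.extend_apply_self, map_sub, inner_sub_left, inner_add_left,
    real_inner_smul_left, real_inner_comm u v]
  ring

end IsSasakian

end Sasakian

/-! ### The curvature of the Tanaka connection -/

section Tanaka
open Filter Topology Module

variable {E : Type*} [NormedAddCommGroup E] [NormedSpace ℝ E] [FiniteDimensional ℝ E]
  {H : Type*} [TopologicalSpace H] {I : ModelWithCorners ℝ E H}
  {M : Type*} [TopologicalSpace M] [ChartedSpace H M] [IsManifold I ∞ M]
  [RiemannianBundle (fun x : M ↦ TangentSpace I x)]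
  [IsContMDiffRiemannianBundle I ∞ E (fun x : M ↦ TangentSpace I x)]

variable {X Y Z W : Π x : M, TangentSpace I x} {x : M}
  {J : Π x : M, TangentSpace I x →L[ℝ] TangentSpace I x}
  {R : Π x : M, TangentSpace I x} {α : Π x : M, TangentSpace I x →L[ℝ] ℝ}

namespace IsSasakian

variable [Nontrivial E]

lemma nabla_J (h : IsSasakian J R α) (hX : SmoothNear X x) (hY : SmoothNear Y x) :
    nabla I M X (fun y ↦ J y (Y y)) x = J x (nabla I M X Y x)
      + (1 / 2 : ℝ) • (inner ℝ (X x) (Y x) • R x - α x (Y x) • X x) := by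
  rw [← h.nablaEndo_eq hX hY, nablaEndo]
  abel

/-- The Levi-Civita derivative of a Tanaka derivative. -/
lemma nabla_tanaka (h : IsSasakian J R α) (hX : SmoothNear X x) (hY : SmoothNear Y x)
    (hZ : SmoothNear Z x) :
    nabla I M X (tanaka J R Y Z) x = nabla I M X (nabla I M Y Z) x
      + (1 / 2 : ℝ) • (α x (Y x) • nabla I M X (fun y ↦ J y (Z y)) x
        + (α x (nabla I M X Y x) - 1 / 2 * inner ℝ (J x (X x)) (Y x)) • J x (Z x)
        + α x (Z x) • nabla I M X (fun y ↦ J y (Y y)) x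
        + (α x (nabla I M X Z x) - 1 / 2 * inner ℝ (J x (X x)) (Z x)) • J x (Y x)
        + (1 / 2 * inner ℝ (J x (Y x)) (Z x)) • J x (X x)
        - (inner ℝ (nabla I M X (fun y ↦ J y (Y y)) x) (Z x)
          + inner ℝ (J x (Y x)) (nabla I M X Z x)) • R x) := by
  have hc := h.toIsContactMetric
  have hR := hc.smoothNear_R (x := x)
  have hJY := hY.apply h.smooth_J
  have hJZ := hZ.apply h.smooth_J
  have e : tanaka J R Y Z = fun y ↦ nabla I M Y Z y + (1 / 2 : ℝ) • (metricFn R Y y • J y (Z y)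
      + metricFn R Z y • J y (Y y) - metricFn (fun y ↦ J y (Y y)) Z y • R y) := by
    ext y
    simp only [tanaka, metricFn]
    module
  have h1 := hJZ.smul (hR.metricFn hY)
  have h2 := hJY.smul (hR.metricFn hZ)
  have h3 := hR.smul (hJY.metricFn hZ)
  rw [e, nabla_add (hY.nabla hZ) (((h1.add h2).sub h3).const_smul _),
    nabla_const_smul _ ((h1.add h2).sub h3), nabla_sub (h1.add h2) h3, nabla_add h1 h2,
    nabla_smul (hR.metricFn hY) hJZ, nabla_smul (hR.metricFn hZ) hJY,
    nabla_smul (hJY.metricFn hZ) hR, mvfderiv_metricFn_nabla hX hR hY,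
    mvfderiv_metricFn_nabla hX hR hZ, mvfderiv_metricFn_nabla hX hJY hZ, h.nabla_R_eq]
  simp only [metricFn, hc.inner_R_left, real_inner_smul_left]
  module

/-- The curvature of the Tanaka connection in terms of the Riemann curvature. -/
lemma inner_curvatureAt_tanaka (h : IsSasakian J R α) {v : TangentSpace I x} (hv : α x v = 0)
    (w : TangentSpace I x) :
    inner ℝ (curvatureAt (tanaka J R) w v v) w
      = riem w v v w + 3 / 4 * inner ℝ (J x v) w ^ 2 - 1 / 4 * ‖v‖ ^ 2 * α x w ^ 2 := by
  have hc := h.toIsContactMetric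
  have hV := smoothNear_extend v
  have hW := smoothNear_extend w
  rw [riem, curvatureAt, curvatureAt]
  have eV : FiberBundle.extend E v x = v := by simp
  have eW : FiberBundle.extend E w x = w := by simp
  set V := FiberBundle.extend E v
  set W := FiberBundle.extend E w
  have R_right (u : TangentSpace I x) : inner ℝ u (R x) = α x u := by
    rw [real_inner_comm, hc.inner_R_left]
  have e1 : tanaka J R W (tanaka J R V V) x = nabla I M W (tanaka J R V V) x
      + (1 / 2 : ℝ) • (α x w • J x (tanaka J R V V x) + α x (tanaka J R V V x) • J x w
        - inner ℝ (J x w) (tanaka J R V V x) • R x) := by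
    rw [tanaka, hc.inner_R_left, hc.inner_R_left, eW]
    module
  have e2 : tanaka J R V (tanaka J R W V) x = nabla I M V (tanaka J R W V) x
      + (1 / 2 : ℝ) • (α x (tanaka J R W V x) • J x v
        - inner ℝ (J x v) (tanaka J R W V x) • R x) := by
    rw [tanaka, hc.inner_R_left, hc.inner_R_left, eV, hv]
    module
  have e3 : tanaka J R (mlieBracket I W V) V x = nabla I M (mlieBracket I W V) V x
      + (1 / 2 : ℝ) • (α x (nabla I M W V x - nabla I M V W x) • J x v
        - inner ℝ (J x (nabla I M W V x - nabla I M V W x)) v • R x) := by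
    rw [tanaka, hc.inner_R_left, hc.inner_R_left, eV, hv, nabla_sub_swap hW hV]
    module
  have e4 : tanaka J R V V x = nabla I M V V x := by
    rw [tanaka, hc.inner_R_left, eV, hv, hc.inner_J_self]
    module
  have e5 : tanaka J R W V x = nabla I M W V x
      + (1 / 2 : ℝ) • (α x w • J x v - inner ℝ (J x w) v • R x) := by
    rw [tanaka, hc.inner_R_left, hc.inner_R_left, eV, eW, hv]
    module
  simp only [curvature]
  rw [e1, e2, e3, e4, e5, h.nabla_tanaka hW hV hV, h.nabla_tanaka hV hW hV, h.nabla_J hW hV,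
    h.nabla_J hV hV, h.nabla_J hV hW, eV, eW]
  generalize nabla I M W (nabla I M V V) x = p
  generalize nabla I M V (nabla I M W V) x = q
  generalize nabla I M (mlieBracket I W V) V x = r
  generalize nabla I M W V x = a
  generalize nabla I M V W x = b
  generalize nabla I M V V x = c
  simp only [hv, map_add, map_sub, map_smul, hc.J_J, hc.form_J, h.form_R, inner_add_left,
    inner_sub_left, inner_add_right, inner_sub_right, real_inner_smul_left, real_inner_smul_right,
    inner_neg_left, hc.inner_R_left, R_right, hc.inner_J_self, hc.inner_J_right, smul_eq_mul,
    ← real_inner_self_eq_norm_sq]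
  have s (u z : TangentSpace I x) : inner ℝ (J x u) z = - inner ℝ (J x z) u := by
    rw [real_inner_comm, hc.inner_J_right]
  rw [s w v, real_inner_comm v w]
  ring

end IsSasakian

end Tanaka

/-! ### Traces and Ricci curvatures -/

section Trace

variable {V : Type*} [NormedAddCommGroup V] [InnerProductSpace ℝ V] [FiniteDimensional ℝ V]
  {ι κ κ' : Type*} [Fintype ι] [Fintype κ] [Fintype κ']

lemma trace_comp_starProjection (S : Submodule ℝ V) (L : V →ₗ[ℝ] V) (c : OrthonormalBasis κ ℝ S) :
    LinearMap.trace ℝ V (L ∘ₗ S.starProjection.toLinearMap)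
      = ∑ i, inner ℝ (L (c i)) (c i : V) := by
  have e : L ∘ₗ S.starProjection.toLinearMap
      = (L ∘ₗ S.subtype) ∘ₗ S.orthogonalProjectionOnto.toLinearMap := rfl
  rw [e, LinearMap.trace_comp_comm', LinearMap.trace_eq_sum_inner _ c]
  refine Finset.sum_congr rfl fun i _ ↦ ?_
  rw [real_inner_comm]
  exact Submodule.inner_orthogonalProjectionOnto_eq_of_mem_right (c i) (L (c i))

/-- A trace may be computed in orthonormal bases of a subspace and of its orthogonal complement. -/
lemma sum_inner_eq_sum_add_sum_orthogonal (S : Submodule ℝ V) (L : V →ₗ[ℝ] V)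
    (b : OrthonormalBasis ι ℝ V) (c : OrthonormalBasis κ ℝ S) (d : OrthonormalBasis κ' ℝ Sᗮ) :
    ∑ i, inner ℝ (L (b i)) (b i)
      = ∑ i, inner ℝ (L (c i)) (c i : V) + ∑ i, inner ℝ (L (d i)) (d i : V) := by
  have e : L = L ∘ₗ S.starProjection.toLinearMap + L ∘ₗ Sᗮ.starProjection.toLinearMap := by
    ext v
    simp
  rw [← trace_comp_starProjection S L c, ← trace_comp_starProjection Sᗮ L d, ← map_add, ← e,
    LinearMap.trace_eq_sum_inner _ b]
  simp only [real_inner_comm]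

end Trace

section Ricci
open Filter Topology Module

variable {E : Type*} [NormedAddCommGroup E] [NormedSpace ℝ E] [FiniteDimensional ℝ E]
  {H : Type*} [TopologicalSpace H] {I : ModelWithCorners ℝ E H}
  {M : Type*} [TopologicalSpace M] [ChartedSpace H M] [IsManifold I ∞ M]
  [RiemannianBundle (fun x : M ↦ TangentSpace I x)]
  [IsContMDiffRiemannianBundle I ∞ E (fun x : M ↦ TangentSpace I x)]

variable {x : M}
  {J : Π x : M, TangentSpace I x →L[ℝ] TangentSpace I x}
  {R : Π x : M, TangentSpace I x} {α : Π x : M, TangentSpace I x →L[ℝ] ℝ}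

namespace IsContactMetric

lemma R_mem_orthogonal (h : IsContactMetric J R α) : R x ∈ (distribution α x)ᗮ := by
  rw [Submodule.mem_orthogonal']
  intro u hu
  rw [h.inner_R_left]
  exact hu

lemma horPart_eq (h : IsContactMetric J R α) (v : TangentSpace I x) :
    horPart α v = v - α x v • R x := by
  refine Submodule.eq_starProjection_of_mem_orthogonal ?_ ?_
  · simp [distribution, h.form_R]
  · rw [sub_sub_cancel]
    exact Submodule.smul_mem _ _ h.R_mem_orthogonal

lemma verPart_eq (h : IsContactMetric J R α) (v : TangentSpace I x) :
    verPart α v = α x v • R x := by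
  have := h.horPart_eq v
  rw [horPart] at this
  rw [verPart, Submodule.starProjection_orthogonal_val, this, sub_sub_cancel]

lemma form_horPart (h : IsContactMetric J R α) (v : TangentSpace I x) :
    α x (horPart α v) = 0 := by
  rw [h.horPart_eq]
  simp [h.form_R]

lemma norm_sq_horPart (h : IsContactMetric J R α) (v : TangentSpace I x) :
    ‖horPart α v‖ ^ 2 = ‖v‖ ^ 2 - α x v ^ 2 := by
  rw [← real_inner_self_eq_norm_sq, ← real_inner_self_eq_norm_sq, h.horPart_eq, inner_sub_left,
    inner_sub_right, inner_sub_right, real_inner_smul_left, real_inner_smul_left,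
    real_inner_smul_right, real_inner_smul_right, h.inner_R, h.inner_R_left, real_inner_comm (R x) v,
    h.inner_R_left]
  ring

lemma norm_sq_verPart (h : IsContactMetric J R α) (v : TangentSpace I x) :
    ‖verPart α v‖ ^ 2 = α x v ^ 2 := by
  rw [← real_inner_self_eq_norm_sq, h.verPart_eq, real_inner_smul_left, real_inner_smul_right,
    h.inner_R]
  ring

lemma finrank_distribution (h : IsContactMetric J R α) :
    finrank ℝ (distribution α x) + 1 = finrank ℝ E := by
  refine Dual.finrank_ker_add_one_of_ne_zero (f := (α x).toLinearMap) fun h0 ↦ ?_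
  have := h.form_R x
  have h1 : α x (R x) = 0 := congrArg (fun L : TangentSpace I x →ₗ[ℝ] ℝ ↦ L (R x)) h0
  linarith

end IsContactMetric

variable [Nontrivial E]

/-- The endomorphism `w ↦ Rm(w, v)v` of the tangent space. -/
def curvatureOperator (v : TangentSpace I x) : TangentSpace I x →ₗ[ℝ] TangentSpace I x where
  toFun w := curvatureAt (nabla I M) w v v
  map_add' w w' := ext_inner_right ℝ fun z ↦ by
    rw [inner_add_left]
    exact riem_add_left w w' v v z
  map_smul' c w := ext_inner_right ℝ fun z ↦ by
    rw [RingHom.id_apply, real_inner_smul_left]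
    exact riem_smul_left c w v v z

lemma partialRicci_eq (S : Submodule ℝ (TangentSpace I x)) (v : TangentSpace I x) :
    partialRicci S v = ∑ i, riem (stdOrthonormalBasis ℝ S i : TangentSpace I x) v v
      (stdOrthonormalBasis ℝ S i : TangentSpace I x) := rfl

/-- The Ricci curvature is the sum of its horizontal and vertical parts. -/
lemma sum_riem (α : Π x : M, TangentSpace I x →L[ℝ] ℝ) (v : TangentSpace I x) :
    ∑ i, riem (stdOrthonormalBasis ℝ (TangentSpace I x) i) v v
      (stdOrthonormalBasis ℝ (TangentSpace I x) i) = ricciH α v + ricciV α v :=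
  sum_inner_eq_sum_add_sum_orthogonal (distribution α x) (curvatureOperator v)
    (stdOrthonormalBasis ℝ (TangentSpace I x)) (stdOrthonormalBasis ℝ (distribution α x))
    (stdOrthonormalBasis ℝ (distribution α x)ᗮ)

namespace IsSasakian

lemma ricciV_eq (h : IsSasakian J R α) (v : TangentSpace I x) :
    ricciV α v = 1 / 4 * ‖horPart α v‖ ^ 2 := by
  have hc := h.toIsContactMetric
  rw [ricciV, partialRicci_eq]
  set b := stdOrthonormalBasis ℝ (distribution α x)ᗮ
  have hb (i) : (b i : TangentSpace I x) = α x (b i) • R x := by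
    rw [← hc.verPart_eq]
    exact (Submodule.starProjection_eq_self_iff.2 (b i).2).symm
  have h1 : riem (R x) v v (R x) = 1 / 4 * ‖horPart α v‖ ^ 2 := by
    rw [riem_skew, h.riem_R, h.form_R, hc.inner_R_left, real_inner_self_eq_norm_sq,
      hc.norm_sq_horPart]
    ring
  have h2 : ∑ i, α x (b i) ^ 2 = 1 := by
    have := b.sum_sq_inner_left ⟨R x, hc.R_mem_orthogonal⟩
    rw [← real_inner_self_eq_norm_sq] at this
    simpa only [Submodule.coe_inner, hc.inner_R_left, h.form_R] using this
  rw [← h1, ← one_mul (riem _ _ _ _), ← h2, Finset.sum_mul]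
  refine Finset.sum_congr rfl fun i _ ↦ ?_
  conv_lhs => rw [hb i, riem_smul_left, riem_smul_right]
  ring

/-- The mixed terms in `Ric^H` vanish, and `Ric^H(R, R) = n / 2`. -/
lemma ricciH_eq (h : IsSasakian J R α) {n : ℕ} (hn : finrank ℝ E = 2 * n + 1)
    (v : TangentSpace I x) :
    ricciH α v = ricciH α (horPart α v) + n / 2 * ‖verPart α v‖ ^ 2 := by
  have hc := h.toIsContactMetric
  rw [ricciH, ricciH, partialRicci_eq, partialRicci_eq]
  set b := stdOrthonormalBasis ℝ (distribution α x)
  have hD : finrank ℝ (distribution α x) = 2 * n := by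
    have := hc.finrank_distribution (x := x)
    omega
  have key (i) : riem (b i : TangentSpace I x) v v (b i)
      = riem (b i : TangentSpace I x) (horPart α v) (horPart α v) (b i) + 1 / 4 * α x v ^ 2 := by
    have hw : α x (b i) = 0 := (b i).2
    have h1 : inner ℝ (b i : TangentSpace I x) (b i : TangentSpace I x) = 1 := by
      rw [← Submodule.coe_inner, real_inner_self_eq_norm_sq, b.norm_eq_one, one_pow]
    have hv : v = horPart α v + α x v • R x := by
      rw [hc.horPart_eq, sub_add_cancel]
    have hu := hc.form_horPart v
    set u := horPart α v
    set a := α x v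
    set w : TangentSpace I x := (b i).1
    conv_lhs => rw [hv]
    rw [riem_add_third, riem_add_second, riem_add_second, riem_smul_third, riem_smul_third,
      riem_smul_second, riem_smul_second, riem_pair_symm w (R x) u w, riem_skew u w w (R x),
      h.riem_R, h.riem_R, h.riem_R, hu, hw, h.form_R, h1]
    ring
  simp only [key, Finset.sum_add_distrib, Finset.sum_const, Finset.card_univ, Fintype.card_fin, hD,
    hc.norm_sq_verPart, nsmul_eq_mul]
  push_cast
  ring

lemma tanakaRicci_eq (h : IsSasakian J R α) {v : TangentSpace I x} (hv : α x v = 0) :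
    tanakaRicci J R v = ricciH α v + 3 / 4 * ‖v‖ ^ 2 := by
  have hc := h.toIsContactMetric
  have h1 := (stdOrthonormalBasis ℝ (TangentSpace I x)).sum_sq_inner_left (J x v)
  have h2 := (stdOrthonormalBasis ℝ (TangentSpace I x)).sum_sq_inner_left (R x)
  have h3 := hc.norm_sq_horPart v
  rw [← real_inner_self_eq_norm_sq (J x v), hc.inner_J_J, hv, real_inner_self_eq_norm_sq] at h1
  rw [← real_inner_self_eq_norm_sq, h.inner_R] at h2
  simp only [hc.inner_R_left] at h2
  simp only [tanakaRicci, h.inner_curvatureAt_tanaka hv, Finset.sum_add_distrib,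
    Finset.sum_sub_distrib, ← Finset.mul_sum, sum_riem α, h.ricciV_eq, h1, h2, h3, hv]
  ring

end IsSasakian

end Ricci

end SasakiGeometry

end

open SasakiGeometry in
theorem proposition2p6 (n : ℕ) {M : Type*} [TopologicalSpace M]
    [ChartedSpace (EuclideanSpace ℝ (Fin (2 * n + 1))) M] [IsManifold (𝓡 (2 * n + 1)) ∞ M]
    [RiemannianBundle (fun x : M ↦ TangentSpace (𝓡 (2 * n + 1)) x)]
    [IsContMDiffRiemannianBundle (𝓡 (2 * n + 1)) ∞ (EuclideanSpace ℝ (Fin (2 * n + 1)))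
      (fun x : M ↦ TangentSpace (𝓡 (2 * n + 1)) x)]
    (J : Π x : M, TangentSpace (𝓡 (2 * n + 1)) x →L[ℝ] TangentSpace (𝓡 (2 * n + 1)) x)
    (R : Π x : M, TangentSpace (𝓡 (2 * n + 1)) x)
    (α : Π x : M, TangentSpace (𝓡 (2 * n + 1)) x →L[ℝ] ℝ)
    (hS : IsSasakian J R α) (x : M) (v : TangentSpace (𝓡 (2 * n + 1)) x) :
    (ricciV α v = ricciV α (horPart α v) ∧
      ricciV α (horPart α v) = 1 / 4 * ‖horPart α v‖ ^ 2) ∧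
    (ricciH α v + 3 * ricciV α (horPart α v) = ricciH α v + 3 / 4 * ‖horPart α v‖ ^ 2 ∧
      ricciH α v + 3 / 4 * ‖horPart α v‖ ^ 2
        = (n : ℝ) / 2 * ‖verPart α v‖ ^ 2 + tanakaRicci J R (horPart α v)) := by
  have hc := hS.toIsContactMetric
  have hV : ricciV α (horPart α v) = 1 / 4 * ‖horPart α v‖ ^ 2 := by
    rw [hS.ricciV_eq, hc.norm_sq_horPart (horPart α v), hc.form_horPart]
    ring
  refine ⟨⟨by rw [hV, hS.ricciV_eq], hV⟩, by rw [hV]; ring, ?_⟩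
  rw [hS.ricciH_eq (n := n) finrank_euclideanSpace_fin, hS.tanakaRicci_eq (hc.form_horPart v)]
  ring
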